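/- Let $k$ be a field and let $F$ be a sheaf of $k$-vector spaces on $\mathbb{R}$ with compact support. Assume that $F$ is constructible: there is a real analytic stratification of $\mathbb{R}$ (a locally finite partition of $\mathbb{R}$ into connected real analytic submanifolds such that a stratum meeting the closure of another one is contained in it) such that the restriction of $F$ to each stratum is a constant sheaf of finite rank. For a nonempty interval $I \subseteq \mathbb{R}$ (open, closed or half-closed) let $k_I$ denote the sheaf on $\mathbb{R}$ that is constant with stalk $k$ on $I$ and extended by zero outside $I$. Then there exist a finite set $A$, pairwise distinct nonempty intervals $I_a \subseteq \mathbb{R}$ and integers $n_a \geq 1$, $a \in A$, such that $$F \simeq \bigoplus_{a\in A} k_{I_a}^{n_a}.$$ Moreover this decomposition is unique: if $F \simeq \bigoplus_{a\in A} k_{I_a}^{n_a}$ and $F \simeq \bigoplus_{b\in B} k_{J_b}^{m_b}$ with $A$, $B$ finite, the $I_a$ pairwise distinct nonempty intervals, the $J_b$ pairwise distinct nonempty intervals, and all $n_a, m_b \geq 1$, then there is a bijection $\sigma \colon A \to B$ such that $J_{\sigma(a)} = I_a$ and $m_{\sigma(a)} = n_a$ for all $a \in A$. -/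

import Mathlib

open CategoryTheory CategoryTheory.Limits TopologicalSpace Opposite Topology

universe u v w

noncomputable section

namespace SheavesOnR

/-! ### Sheaves of vector spaces

The coefficient field may live in any universe while the spaces are in `Type`; the instances below
only say that Mathlib's limits, colimits and sheafification are available in that situation. -/

instance (k : Type u) [Field k] : HasColimitsOfSize.{0, 0} (ModuleCat.{u} k) :=
  hasColimitsOfSizeShrink.{0, 0, u, u} _

instance (k : Type u) [Field k] : HasLimitsOfSize.{0, 0} (ModuleCat.{u} k) :=
  hasLimitsOfSizeShrink.{0, 0, u, u} _

instance (k : Type u) [Field k] : PreservesLimitsOfSize.{0, 0} (forget (ModuleCat.{u} k)) :=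
  preservesLimitsOfSize_shrink.{0, u, 0, u} _

instance (k : Type u) [Field k] :
    PreservesFilteredColimitsOfSize.{0, 0} (forget (ModuleCat.{u} k)) :=
  preservesFilteredColimitsOfSize_shrink.{0, u, 0, u} _

instance (k : Type u) [Field k] (X : TopCat.{0}) :
    HasSheafify (Opens.grothendieckTopology X) (ModuleCat.{u} k) :=
  inferInstance

/-- The category of sheaves of `k`-vector spaces on `X`. -/
abbrev Sh (k : Type u) [Field k] (X : Type) [TopologicalSpace X] :=
  TopCat.Sheaf (ModuleCat.{u} k) (TopCat.of X)

instance (k : Type u) [Field k] (X : Type) [TopologicalSpace X] : HasFiniteBiproducts (Sh k X) :=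
  Abelian.hasFiniteBiproducts

/-! ### The sheaf `k_I` -/

/-- The condition for `f : U → k` to be a section over `U` of `k_Z = i_! k`, where `i` is the
inclusion of a locally closed subset `Z` of `ℝ`: `f` restricts to a locally constant function on
`Z ∩ U`, vanishes outside `Z`, and its support `{f ≠ 0}` is closed in `U`. -/
def IsExtSection {k : Type u} [Field k] (Z : Set ℝ) {U : Opens (TopCat.of ℝ)} (f : U → k) : Prop :=
  (∀ x : U, x.1 ∉ Z → f x = 0) ∧
    IsLocallyConstant (fun x : {x : U // x.1 ∈ Z} => f x.1) ∧
    IsClosed {x : U | f x ≠ 0}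

theorem isExtSection_iff {k : Type u} [Field k] (Z : Set ℝ) {U : Opens (TopCat.of ℝ)} (f : U → k) :
    IsExtSection Z f ↔ (∀ x : U, x.1 ∉ Z → f x = 0) ∧
      (∀ x : U, x.1 ∈ Z → ∀ᶠ y in 𝓝 x, y.1 ∈ Z → f y = f x) ∧
      (∀ x : U, f x = 0 → ∀ᶠ y in 𝓝 x, f y = 0) := by
  unfold IsExtSection
  refine and_congr Iff.rfl (and_congr ?_ ?_)
  · rw [IsLocallyConstant.iff_eventually_eq]
    constructor
    · intro h x hx
      have := h ⟨x, hx⟩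
      rw [nhds_subtype_eq_comap, Filter.eventually_comap] at this
      filter_upwards [this] with y hy hyZ using hy ⟨y, hyZ⟩ rfl
    · intro h x
      rw [nhds_subtype_eq_comap, Filter.eventually_comap]
      filter_upwards [h x.1 x.2] with y hy a ha
      subst ha
      exact hy a.2
  · rw [← isOpen_compl_iff, isOpen_iff_eventually]
    simp

/-- The space of sections of `k_Z` over `U`. -/
def extSections (k : Type u) [Field k] (Z : Set ℝ) (U : Opens (TopCat.of ℝ)) :
    Submodule k (U → k) where
  carrier := {f | IsExtSection Z f}
  zero_mem' := ⟨fun _ _ => rfl, IsLocallyConstant.const 0, by simp⟩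
  add_mem' := by
    intro f g hf hg
    simp only [Set.mem_ofPred_eq, isExtSection_iff] at hf hg ⊢
    have h0 : ∀ x : U, x.1 ∉ Z → (f + g) x = 0 := fun x hx => by simp [hf.1 x hx, hg.1 x hx]
    have h1 : ∀ x : U, x.1 ∈ Z → ∀ᶠ y in 𝓝 x, y.1 ∈ Z → (f + g) y = (f + g) x := by
      intro x hx
      filter_upwards [hf.2.1 x hx, hg.2.1 x hx] with y h h' hy
      simp [h hy, h' hy]
    refine ⟨h0, h1, fun x hx => ?_⟩
    by_cases hxZ : x.1 ∈ Z
    · filter_upwards [h1 x hxZ] with y hy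
      by_cases hyZ : y.1 ∈ Z
      · rw [hy hyZ, hx]
      · exact h0 y hyZ
    · filter_upwards [hf.2.2 x (hf.1 x hxZ), hg.2.2 x (hg.1 x hxZ)] with y h h'
      simp [h, h']
  smul_mem' := by
    rintro c f ⟨hf0, hf, hfc⟩
    refine ⟨fun x hx => by simp [hf0 x hx], hf.comp (c • ·), ?_⟩
    by_cases hc : c = 0
    · simp [hc]
    · simpa [hc] using hfc

theorem isExtSection_res {k : Type u} [Field k] (Z : Set ℝ) {U V : Opens (TopCat.of ℝ)}
    (i : U ⟶ V) (f : V → k) (hf : IsExtSection Z f) :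
    IsExtSection Z (fun x : U => f ⟨x.1, i.le x.2⟩) := by
  have hc : Continuous (fun x : U => (⟨x.1, i.le x.2⟩ : V)) := by fun_prop
  rw [isExtSection_iff] at hf ⊢
  exact ⟨fun x hx => hf.1 _ hx, fun x hx => hc.continuousAt.eventually (hf.2.1 _ hx),
    fun x hx => hc.continuousAt.eventually (hf.2.2 _ hx)⟩

theorem isExtSection_locality {k : Type u} [Field k] (Z : Set ℝ) {U : Opens (TopCat.of ℝ)}
    (f : U → k) (hf : ∀ x : U, ∃ (V : Opens (TopCat.of ℝ)) (_ : x.1 ∈ V) (i : V ⟶ U),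
      IsExtSection Z (fun y : V => f ⟨y.1, i.le y.2⟩)) : IsExtSection Z f := by
  have key : ∀ (V : Opens (TopCat.of ℝ)) (i : V ⟶ U) (x : V) (P : U → Prop),
      (∀ᶠ y : V in 𝓝 x, P ⟨y.1, i.le y.2⟩) → ∀ᶠ y in 𝓝 (⟨x.1, i.le x.2⟩ : U), P y := by
    intro V i x P h
    have := (Opens.isOpenEmbedding_of_le i.le).map_nhds_eq x
    exact (this ▸ Filter.eventually_map.2 h :)
  rw [isExtSection_iff]
  refine ⟨fun x hx => ?_, fun x hx => ?_, fun x hx => ?_⟩ <;>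
    obtain ⟨V, hxV, i, h⟩ := hf x <;> rw [isExtSection_iff] at h
  · exact h.1 ⟨x.1, hxV⟩ hx
  · exact key V i ⟨x.1, hxV⟩ (fun y => y.1 ∈ Z → f y = f x) (h.2.1 ⟨x.1, hxV⟩ hx)
  · exact key V i ⟨x.1, hxV⟩ (fun y => f y = 0) (h.2.2 ⟨x.1, hxV⟩ hx)

/-- The property of being a section of `k_Z`, as a local predicate on functions. -/
def extPredicate (k : Type u) [Field k] (Z : Set ℝ) :
    TopCat.LocalPredicate (X := TopCat.of ℝ) (fun _ => k) where
  pred f := IsExtSection Z f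
  res i f hf := isExtSection_res Z i f hf
  locality f hf := isExtSection_locality Z f hf

/-- The presheaf of vector spaces `U ↦ extSections k Z U`, with restriction of functions. -/
def extPresheaf (k : Type u) [Field k] (Z : Set ℝ) :
    TopCat.Presheaf (ModuleCat.{u} k) (TopCat.of ℝ) where
  obj U := ModuleCat.of k (extSections k Z U.unop)
  map i := ModuleCat.ofHom
    { toFun := fun f => ⟨fun x => f.1 ⟨x.1, i.unop.le x.2⟩, isExtSection_res Z i.unop f.1 f.2⟩
      map_add' := fun _ _ => rfl
      map_smul' := fun _ _ => rfl }

theorem extPresheaf_isSheaf (k : Type u) [Field k] (Z : Set ℝ) : (extPresheaf k Z).IsSheaf :=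
  (TopCat.Presheaf.isSheaf_iff_isSheaf_comp' (forget (ModuleCat.{u} k)) (extPresheaf k Z)).2
    (TopCat.subpresheafToTypes.isSheaf (extPredicate k Z))

/-- The sheaf `k_Z` on `ℝ`, for `Z` locally closed: constant with stalk `k` on `Z` and extended by
zero outside `Z`. -/
def kSheaf (k : Type u) [Field k] (Z : Set ℝ) : Sh k ℝ :=
  ⟨extPresheaf k Z, extPresheaf_isSheaf k Z⟩

/-! ### Constructible sheaves on `ℝ` -/

/-- The inclusion of a subset of `ℝ`. -/
def incl (S : Set ℝ) : TopCat.of S ⟶ TopCat.of ℝ :=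
  TopCat.ofHom ⟨Subtype.val, continuous_subtype_val⟩

/-- The inverse image functor `f⁻¹`, left adjoint to the direct image `f_*`. -/
def inverseImage (k : Type u) [Field k] {X Y : TopCat.{0}} (f : X ⟶ Y) :
    TopCat.Sheaf (ModuleCat.{u} k) Y ⥤ TopCat.Sheaf (ModuleCat.{u} k) X :=
  (Opens.map f).sheafPullback (ModuleCat.{u} k)
    (Opens.grothendieckTopology Y) (Opens.grothendieckTopology X)

/-- The restriction `F|_S`, that is, the inverse image of `F` under the inclusion of `S`. -/
def restrict {k : Type u} [Field k] (F : Sh k ℝ) (S : Set ℝ) : Sh k S :=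
  (inverseImage k (incl S)).obj F

/-- The constant sheaf with stalk `V`. -/
def constSheaf {k : Type u} [Field k] (X : Type) [TopologicalSpace X] (V : ModuleCat.{u} k) :
    Sh k X :=
  (constantSheaf (Opens.grothendieckTopology (TopCat.of X)) (ModuleCat.{u} k)).obj V

/-- The sheaf is isomorphic to a constant sheaf with finite dimensional stalk. -/
def IsConstantOfFiniteRank {k : Type u} [Field k] {X : Type} [TopologicalSpace X] (G : Sh k X) :
    Prop :=
  ∃ V : ModuleCat.{u} k, Module.Finite k V ∧ Nonempty (G ≅ constSheaf X V)

open scoped Manifold ContDiff in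
/-- Real analytic (embedded, not necessarily closed) submanifolds of `ℝ`: near each of its points,
the set is mapped to a linear subspace by a real analytic local coordinate. -/
def IsAnalyticSubmanifold (S : Set ℝ) : Prop :=
  ∀ x ∈ S, ∃ φ ∈ contDiffGroupoid ω 𝓘(ℝ, ℝ), x ∈ φ.source ∧
    ∃ W : Submodule ℝ ℝ, S ∩ φ.source = φ.source ∩ φ ⁻¹' W

/-- Real analytic stratifications of `ℝ`: locally finite partitions into connected real analytic
submanifolds, subject to the frontier condition. -/
structure IsAnalyticStratification (𝒮 : Set (Set ℝ)) : Prop where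
  partition : Setoid.IsPartition 𝒮
  locallyFinite : LocallyFinite (fun S : 𝒮 => (S : Set ℝ))
  submanifold : ∀ S ∈ 𝒮, IsAnalyticSubmanifold S
  connected : ∀ S ∈ 𝒮, _root_.IsConnected S
  frontier : ∀ S ∈ 𝒮, ∀ T ∈ 𝒮, (S ∩ closure T).Nonempty → S ⊆ closure T

/-- Constructible sheaves on `ℝ`: for some real analytic stratification, the restriction to each
stratum is constant of finite rank. -/
def IsConstructible {k : Type u} [Field k] (F : Sh k ℝ) : Prop :=
  ∃ 𝒮 : Set (Set ℝ), IsAnalyticStratification 𝒮 ∧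
    ∀ S ∈ 𝒮, IsConstantOfFiniteRank (restrict F S)

/-- The support of `F`: the complement of the union of the open sets `U` with `F|_U = 0`, that is,
with `F(V) = 0` for all open `V ⊆ U`. -/
def supp {k : Type u} [Field k] (F : Sh k ℝ) : Set ℝ :=
  (⋃ U ∈ {U : Opens (TopCat.of ℝ) | ∀ V ≤ U, IsZero (F.presheaf.obj (op V))}, (U : Set ℝ))ᶜ

/-! ### Decompositions -/

/-- Nonempty intervals of `ℝ`, of any kind (open, closed or half-closed, bounded or not). -/
def IsInterval (I : Set ℝ) : Prop :=
  I.Nonempty ∧ I.OrdConnected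

/-- `F ≃ ⨁_a k_{I_a}^{n_a}` where the `I_a` are intervals. -/
def IsDecomposition {k : Type u} [Field k] (F : Sh k ℝ) {A : Type w} [Finite A]
    (I : A → Set ℝ) (n : A → ℕ) : Prop :=
  (∀ a, IsInterval (I a)) ∧
    Nonempty (F ≅ ⨁ fun a => ⨁ fun _ : Fin (n a) => kSheaf k (I a))

end SheavesOnR

end

/-!
Existence: outside finitely many points `t₁ < ⋯ < tₙ`, the sheaf `F` is constant on intervals, so it
amounts to its stalks at the points `tᵢ` and on the intervals between them, together with the
generization maps from the stalk at `tᵢ` to those on the two neighbouring intervals. This is a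
zigzag of finite dimensional vector spaces. A nonzero zigzag splits off a bar, that is, a summand
which is `k` on a segment of indices with identity maps inside it: take the segment to end at the
last nonzero place and extend it to the left for as long as possible, treating maps of either
direction as linear relations. A bar is the zigzag of `k_I` for an interval `I`.

Uniqueness: a morphism `k_I ⟶ k_J` is multiplication by a function on `I`, which is constant if
`I = J`, and the composite of morphisms `k_I ⟶ k_J ⟶ k_I` vanishes if `I ≠ J`. Hence an isomorphism
between two direct sums of such sheaves restricts to an isomorphism between the blocks belonging to
a given interval, and the ranks of these blocks agree.
-/

noncomputable section

namespace SheavesOnR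

/-! ### Sections -/

section Sections

variable {k : Type u} [Field k] {X : TopCat.{0}}

/-- The restriction map between the spaces of sections of a sheaf. -/
def res (F : TopCat.Sheaf (ModuleCat.{u} k) X) {U V : Opens X} (h : V ≤ U) :
    F.obj.obj (op U) →ₗ[k] F.obj.obj (op V) :=
  (F.obj.map (homOfLE h).op).hom

/-- The linear map induced on sections over `U` by a morphism of sheaves. -/
def homApply {F G : TopCat.Sheaf (ModuleCat.{u} k) X} (α : F ⟶ G) (U : Opens X) :
    F.obj.obj (op U) →ₗ[k] G.obj.obj (op U) :=
  (α.hom.app (op U)).hom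

variable (F : TopCat.Sheaf (ModuleCat.{u} k) X) {G H : TopCat.Sheaf (ModuleCat.{u} k) X}

theorem res_res {U V W : Opens X} (h : V ≤ U) (h' : W ≤ V) (s : F.obj.obj (op U)) :
    res F h' (res F h s) = res F (h'.trans h) s :=
  congrArg (fun f => f.hom s) (F.obj.map_comp (homOfLE h).op (homOfLE h').op).symm

theorem res_self {U : Opens X} (h : U ≤ U) (s : F.obj.obj (op U)) : res F h s = s :=
  congrArg (fun f => f.hom s) (F.obj.map_id (op U))

variable {F}

theorem homApply_res (α : F ⟶ G) {U V : Opens X} (h : V ≤ U) (s : F.obj.obj (op U)) :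
    homApply α V (res F h s) = res G h (homApply α U s) :=
  congrArg (fun f => f.hom s) (α.hom.naturality (homOfLE h).op)

theorem homApply_comp (α : F ⟶ G) (β : G ⟶ H) (U : Opens X) (s : F.obj.obj (op U)) :
    homApply (α ≫ β) U s = homApply β U (homApply α U s) :=
  rfl

theorem homApply_sum {ι : Type*} (A : Finset ι) (α : ι → (F ⟶ G)) (U : Opens X)
    (s : F.obj.obj (op U)) : homApply (∑ i ∈ A, α i) U s = ∑ i ∈ A, homApply (α i) U s :=
  map_sum (AddMonoidHom.mk' (fun α : F ⟶ G => homApply α U s) fun _ _ => rfl) α A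

theorem eq_of_locally_res_eq {U : Opens X} {s t : F.obj.obj (op U)}
    (h : ∀ x ∈ U, ∃ (V : Opens X) (hV : V ≤ U), x ∈ V ∧ res F hV s = res F hV t) : s = t := by
  choose V hV hx hst using h
  exact F.eq_of_locally_eq' (fun x : U => V x.1 x.2) U (fun x => homOfLE (hV x.1 x.2))
    (fun x hxU => Opens.mem_iSup.2 ⟨⟨x, hxU⟩, hx x hxU⟩) s t fun x => hst x.1 x.2

theorem eq_of_res_eq_of_le_sup {U A B : Opens X} (hA : A ≤ U) (hB : B ≤ U) (hU : U ≤ A ⊔ B)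
    {s t : F.obj.obj (op U)} (h : res F hA s = res F hA t) (h' : res F hB s = res F hB t) :
    s = t :=
  F.eq_of_locally_eq₂ (homOfLE hA) (homOfLE hB) hU s t h h'

theorem exists_res_eq_of_le_sup {U A B : Opens X} (hA : A ≤ U) (hB : B ≤ U) (hU : U ≤ A ⊔ B)
    (s : F.obj.obj (op A)) (t : F.obj.obj (op B))
    (h : res F (inf_le_left : A ⊓ B ≤ A) s = res F (inf_le_right : A ⊓ B ≤ B) t) :
    ∃ r : F.obj.obj (op U), res F hA r = s ∧ res F hB r = t := by
  obtain ⟨r, hr, -⟩ := F.existsUnique_gluing' (fun b : Bool => cond b A B) U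
    (fun b => homOfLE (by cases b; exacts [hB, hA]))
    (fun x hx => (hU hx).elim (fun hx => Opens.mem_iSup.2 ⟨true, hx⟩)
      fun hx => Opens.mem_iSup.2 ⟨false, hx⟩)
    (fun b => by cases b; exacts [t, s]) (by
      rintro (_ | _) (_ | _)
      · rfl
      · have h' := congrArg (res F (inf_comm B A).le) h.symm
        rwa [res_res, res_res] at h'
      · exact h
      · rfl)
  exact ⟨r, hr true, hr false⟩

theorem bijective_res_of_le_sup {U A B : Opens X} (hA : A ≤ U) (hB : B ≤ U) (hU : U ≤ A ⊔ B)
    (h : Function.Bijective (res F (inf_le_left : A ⊓ B ≤ A))) : Function.Bijective (res F hB) := by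
  have hres {s t : F.obj.obj (op U)} (hst : res F hB s = res F hB t) :
      res F hA s = res F hA t := by
    refine h.1 ?_
    have hst' := congrArg (res F (inf_le_right : A ⊓ B ≤ B)) hst
    rw [res_res, res_res] at hst' ⊢
    exact hst'
  refine ⟨fun s t hst => eq_of_res_eq_of_le_sup hA hB hU (hres hst) hst, fun t => ?_⟩
  obtain ⟨s, hs⟩ := h.2 (res F inf_le_right t)
  obtain ⟨r, -, hr⟩ := exists_res_eq_of_le_sup hA hB hU s t hs
  exact ⟨r, hr⟩

theorem isIso_of_locally_bijective (α : F ⟶ G)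
    (hinj : ∀ (U : Opens X) (s : F.obj.obj (op U)), homApply α U s = 0 → s = 0)
    (hsurj : ∀ (U : Opens X) (t : G.obj.obj (op U)), ∀ x ∈ U, ∃ (V : Opens X) (hV : V ≤ U),
      x ∈ V ∧ ∃ s : F.obj.obj (op V), homApply α V s = res G hV t) : IsIso α := by
  refine (Sheaf.isLocallyBijective_iff_isIso (J := Opens.grothendieckTopology X) α).1 ⟨?_, ?_⟩
  · exact Presheaf.isLocallyInjective_of_injective _ α.hom fun U =>
      (injective_iff_map_eq_zero (homApply α U.unop)).2 (hinj U.unop)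
  · change Presheaf.IsLocallySurjective _ α.hom
    refine ⟨fun {U} t x hx => ?_⟩
    obtain ⟨V, hV, hxV, s, hs⟩ := hsurj U t x hx
    exact ⟨V, homOfLE hV, ⟨s, hs⟩, hxV⟩

theorem exists_le_of_eventually {U : Opens X} {x : X} (hx : x ∈ U) {P : U → Prop}
    (h : ∀ᶠ y in 𝓝 (⟨x, hx⟩ : U), P y) :
    ∃ (V : Opens X) (hV : V ≤ U), x ∈ V ∧ ∀ y (hy : y ∈ V), P ⟨y, hV hy⟩ := by
  obtain ⟨A, hA, hAo, hxA⟩ := eventually_nhds_iff.1 h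
  refine ⟨⟨Subtype.val '' A, U.isOpen.isOpenMap_subtype_val A hAo⟩, ?_, ⟨_, hxA, rfl⟩, ?_⟩
  · rintro _ ⟨y, -, rfl⟩
    exact y.2
  · rintro _ ⟨y, hy, rfl⟩
    exact hA y hy

end Sections

/-! ### Constant sheaves -/

section Constant

variable {k : Type u} [Field k]

theorem wEqualsLocallyBijective (k : Type u) [Field k] (X : TopCat.{0}) :
    (Opens.grothendieckTopology X).WEqualsLocallyBijective (ModuleCat.{u} k) := by
  -- Mathlib's criterion wants a site in the universe of the coefficients.
  have : EssentiallySmall.{u} (Opens X) := essentiallySmall_of_small_of_locallySmall _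
  have : HasSheafify ((equivSmallModel.{u} (Opens X)).inverse.inducedTopology
    (Opens.grothendieckTopology X)) (ModuleCat.{u} k) := inferInstance
  exact GrothendieckTopology.WEqualsLocallyBijective.ofEssentiallySmall.{_, _, _, _, u} _

variable {X : Type} [TopologicalSpace X] (V : ModuleCat.{u} k)

/-- The sheafification morphism from the constant presheaf to the constant sheaf. -/
def toConstSheaf : (Functor.const (Opens (TopCat.of X))ᵒᵖ).obj V ⟶ (constSheaf X V).obj :=
  toSheafify (Opens.grothendieckTopology (TopCat.of X)) _

/-- The section over `U` of the constant sheaf defined by a vector. -/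
def constSection (U : Opens (TopCat.of X)) : V →ₗ[k] (constSheaf X V).obj.obj (op U) :=
  ((toConstSheaf V).app (op U)).hom

theorem res_constSection {U W : Opens (TopCat.of X)} (h : W ≤ U) (v : V) :
    res (constSheaf X V) h (constSection V U v) = constSection V W v :=
  (congrArg (fun f => f.hom v) ((toConstSheaf V).naturality (homOfLE h).op)).symm

theorem constSection_injective {U : Opens (TopCat.of X)} {x : X} (hx : x ∈ U) :
    Function.Injective (constSection V U) := by
  intro v w h
  have := wEqualsLocallyBijective k (TopCat.of X)
  have : Presheaf.IsLocallyInjective (Opens.grothendieckTopology (TopCat.of X)) (toConstSheaf V) :=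
    ((Opens.grothendieckTopology (TopCat.of X)).W_toSheafify _).isLocallyInjective
  obtain ⟨W, i, hi, -⟩ := Presheaf.equalizerSieve_mem (Opens.grothendieckTopology (TopCat.of X))
    (toConstSheaf V) (X := op U) v w h x hx
  exact hi

theorem exists_res_eq_constSection {U : Opens (TopCat.of X)} (s : (constSheaf X V).obj.obj (op U))
    {x : X} (hx : x ∈ U) : ∃ (W : Opens (TopCat.of X)) (hW : W ≤ U) (v : V), x ∈ W ∧
      res (constSheaf X V) hW s = constSection V W v := by
  have := wEqualsLocallyBijective k (TopCat.of X)
  have : Presheaf.IsLocallySurjective (Opens.grothendieckTopology (TopCat.of X)) (toConstSheaf V) :=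
    ((Opens.grothendieckTopology (TopCat.of X)).W_toSheafify _).isLocallySurjective
  obtain ⟨W, i, ⟨v, hv⟩, hxW⟩ := Presheaf.imageSieve_mem
    (Opens.grothendieckTopology (TopCat.of X)) (toConstSheaf V) (U := op U) s x hx
  exact ⟨W, i.le, v, hxW, hv.symm⟩

theorem constSection_surjective {U : Opens (TopCat.of X)} (hU : IsPreconnected (U : Set X))
    {x : X} (hx : x ∈ U) : Function.Surjective (constSection V U) := by
  intro s
  choose W hW v hxW hv using fun y : U => exists_res_eq_constSection V s y.2
  have hv_locallyConstant : IsLocallyConstant v := by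
    rw [IsLocallyConstant.iff_exists_open]
    refine fun y => ⟨Subtype.val ⁻¹' (W y : Set X), (W y).isOpen.preimage continuous_subtype_val,
      hxW y, fun z hz => ?_⟩
    have hz' : z.1 ∈ W z ⊓ W y := ⟨hxW z, hz⟩
    apply constSection_injective V hz'
    rw [← res_constSection V (inf_le_left : W z ⊓ W y ≤ W z),
      ← res_constSection V (inf_le_right : W z ⊓ W y ≤ W y), ← hv, ← hv, res_res, res_res]
  have : PreconnectedSpace U := Subtype.preconnectedSpace hU
  refine ⟨v ⟨x, hx⟩, eq_of_locally_res_eq fun y hy => ⟨W ⟨y, hy⟩, hW _, hxW ⟨y, hy⟩, ?_⟩⟩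
  rw [res_constSection, hv, hv_locallyConstant.apply_eq_of_preconnectedSpace ⟨x, hx⟩ ⟨y, hy⟩]

theorem constSection_bijective {U : Opens (TopCat.of X)} (hU : IsPreconnected (U : Set X))
    {x : X} (hx : x ∈ U) : Function.Bijective (constSection V U) :=
  ⟨constSection_injective V hx, constSection_surjective V hU hx⟩

theorem homApply_bijective {X : TopCat.{0}} {F G : TopCat.Sheaf (ModuleCat.{u} k) X} (e : F ≅ G)
    (U : Opens X) : Function.Bijective (homApply e.hom U) :=
  (((sheafToPresheaf _ _).mapIso e).app (op U)).toLinearEquiv.bijective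

namespace IsConstantOfFiniteRank

variable {G : Sh k X}

theorem finite (hG : IsConstantOfFiniteRank G) {U : Opens (TopCat.of X)}
    (hU : IsPreconnected (U : Set X)) {x : X} (hx : x ∈ U) :
    Module.Finite k (G.obj.obj (op U)) := by
  obtain ⟨V, hV, ⟨e⟩⟩ := hG
  have := Module.Finite.of_surjective _ (constSection_surjective V hU hx)
  exact Module.Finite.of_surjective _ (homApply_bijective e.symm U).2

theorem bijective_res (hG : IsConstantOfFiniteRank G) {U W : Opens (TopCat.of X)} (h : W ≤ U)
    (hU : IsPreconnected (U : Set X)) (hW : IsPreconnected (W : Set X)) {x : X} (hx : x ∈ W) :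
    Function.Bijective (res G h) := by
  obtain ⟨V, -, ⟨e⟩⟩ := hG
  have hconst : Function.Bijective (res (constSheaf X V) h) := by
    have hcomp : ⇑(res (constSheaf X V) h) ∘ constSection V U = constSection V W :=
      funext (res_constSection V h)
    exact (Function.Bijective.of_comp_iff _ (constSection_bijective V hU (h hx))).1
      (hcomp ▸ constSection_bijective V hW hx)
  have hcomm : ⇑(homApply e.hom W) ∘ res G h = res (constSheaf X V) h ∘ homApply e.hom U :=
    funext (homApply_res e.hom h)
  exact (Function.Bijective.of_comp_iff' (homApply_bijective e W) _).1
    (hcomm ▸ hconst.comp (homApply_bijective e U))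

end IsConstantOfFiniteRank

end Constant

/-! ### Inverse images -/

section InverseImage

variable (k : Type u) [Field k] {X Y : TopCat.{0}} (f : X ⟶ Y)

/-- The adjunction between the inverse and the direct image. -/
def inverseImageAdjunction :
    inverseImage k f ⊣ TopCat.Sheaf.pushforward (ModuleCat.{u} k) f :=
  (Opens.map f).sheafAdjunctionContinuous (ModuleCat.{u} k)
    (Opens.grothendieckTopology Y) (Opens.grothendieckTopology X)

variable {f}

/-- The inverse image under an open embedding, given by the sections over open subsets of the
source; it needs no sheafification. -/
def openInverseImage (hf : IsOpenEmbedding f) :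
    TopCat.Sheaf (ModuleCat.{u} k) Y ⥤ TopCat.Sheaf (ModuleCat.{u} k) X :=
  haveI := hf.functor_isContinuous
  hf.isOpenMap.functor.sheafPushforwardContinuous (ModuleCat.{u} k)
    (Opens.grothendieckTopology X) (Opens.grothendieckTopology Y)

/-- The comparison of the two inverse images under an open embedding: both are left adjoint to the
direct image. -/
def inverseImageIsoOpen (hf : IsOpenEmbedding f) : inverseImage k f ≅ openInverseImage k hf :=
  haveI := hf.functor_isContinuous
  (inverseImageAdjunction k f).leftAdjointUniq
    (hf.isOpenMap.adjunction.sheafPushforwardContinuous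
      (E := ModuleCat.{u} k) (Opens.grothendieckTopology X) (Opens.grothendieckTopology Y))

end InverseImage

section OpenRestriction

variable {k : Type u} [Field k]

theorem IsInterval.isPreconnected {I : Set ℝ} (hI : IsInterval I) : _root_.IsPreconnected I :=
  hI.2.isPreconnected

/-- What is used of the constancy of `F|_S` for `S` open: the restriction maps of `F` between open
intervals contained in `S` are bijective, and the spaces of sections are finite dimensional. -/
structure IsConstOn (F : Sh k ℝ) (S : Set ℝ) : Prop where
  bijective_res : ∀ {U W : Opens (TopCat.of ℝ)} (h : W ≤ U), (U : Set ℝ) ⊆ S →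
    IsInterval (U : Set ℝ) → IsInterval (W : Set ℝ) → Function.Bijective (res F h)
  finite : ∀ U : Opens (TopCat.of ℝ), (U : Set ℝ) ⊆ S → IsInterval (U : Set ℝ) →
    Module.Finite k (F.obj.obj (op U))

variable {F : Sh k ℝ} {S : Set ℝ}

theorem IsConstOn.mono {T : Set ℝ} (hF : IsConstOn F S) (h : T ⊆ S) : IsConstOn F T :=
  ⟨fun hWU hU => hF.bijective_res hWU (hU.trans h), fun U hU => hF.finite U (hU.trans h)⟩

theorem isOpenEmbedding_incl (hS : IsOpen S) : IsOpenEmbedding (incl S) :=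
  hS.isOpenEmbedding_subtypeVal

theorem exists_functor_obj_eq (hS : IsOpen S) {U : Opens (TopCat.of ℝ)} (hU : (U : Set ℝ) ⊆ S)
    (hc : _root_.IsPreconnected (U : Set ℝ)) :
    ∃ U' : Opens (TopCat.of S), _root_.IsPreconnected (U' : Set S) ∧
      (isOpenEmbedding_incl hS).isOpenMap.functor.obj U' = U := by
  have himg : Subtype.val '' (Subtype.val ⁻¹' (U : Set ℝ) : Set S) = U := by
    rw [Subtype.image_preimage_coe, Set.inter_eq_right.2 hU]
  exact ⟨⟨_, U.isOpen.preimage continuous_subtype_val⟩,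
    hS.isOpenEmbedding_subtypeVal.isInducing.isPreconnected_image.1 (himg.symm ▸ hc),
    Opens.ext himg⟩

theorem isConstOn_of_restrict (hS : IsOpen S) (hF : IsConstantOfFiniteRank (restrict F S)) :
    IsConstOn F S := by
  have hF' : IsConstantOfFiniteRank ((openInverseImage k (isOpenEmbedding_incl hS)).obj F) := by
    obtain ⟨V, hV, ⟨e⟩⟩ := hF
    exact ⟨V, hV, ⟨((inverseImageIsoOpen k (isOpenEmbedding_incl hS)).app F).symm ≪≫ e⟩⟩
  refine ⟨fun {U W} h hUS hU hW => ?_, fun U hUS hU => ?_⟩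
  · obtain ⟨U', hU', rfl⟩ := exists_functor_obj_eq hS hUS hU.isPreconnected
    obtain ⟨W', hW', rfl⟩ := exists_functor_obj_eq hS (Set.Subset.trans h hUS) hW.isPreconnected
    obtain ⟨_, y, hy, -⟩ := hW.1
    have hle : W' ≤ U' := (Set.image_subset_image_iff Subtype.val_injective).1 h
    exact hF'.bijective_res hle hU' hW' hy
  · obtain ⟨U', hU', rfl⟩ := exists_functor_obj_eq hS hUS hU.isPreconnected
    obtain ⟨_, y, hy, -⟩ := hU.1
    exact hF'.finite hU' hy

end OpenRestriction

/-! ### Germs -/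

section Germ

variable {k : Type u} [Field k] {X : TopCat.{0}} (F : TopCat.Sheaf (ModuleCat.{u} k) X)

/-- The stalk of `F` at `x`. Mathlib's `TopCat.Presheaf.stalk` wants the coefficients and the space
in the same universe. -/
def stalk (x : X) : ModuleCat.{u} k :=
  colimit ((OpenNhds.inclusion x).op ⋙ F.obj)

/-- The germ at `x` of a section over `U`. -/
def germ {U : Opens X} {x : X} (hx : x ∈ U) : F.obj.obj (op U) →ₗ[k] stalk F x :=
  (colimit.ι ((OpenNhds.inclusion x).op ⋙ F.obj) (op ⟨U, hx⟩)).hom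

theorem germ_res {U V : Opens X} {x : X} (h : V ≤ U) (hx : x ∈ V) (s : F.obj.obj (op U)) :
    germ F hx (res F h s) = germ F (h hx) s :=
  congrArg (fun f => f.hom s) (colimit.w ((OpenNhds.inclusion x).op ⋙ F.obj)
    (homOfLE h : (⟨V, hx⟩ : OpenNhds x) ⟶ ⟨U, h hx⟩).op)

variable {F}

theorem exists_res_eq_of_germ_eq {U V : Opens X} {x : X} {hU : x ∈ U} {hV : x ∈ V}
    {s : F.obj.obj (op U)} {t : F.obj.obj (op V)} (h : germ F hU s = germ F hV t) :
    ∃ (W : Opens X) (hWU : W ≤ U) (hWV : W ≤ V), x ∈ W ∧ res F hWU s = res F hWV t := by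
  obtain ⟨W, i, j, hst⟩ := (colimit.isColimit ((OpenNhds.inclusion x).op ⋙ F.obj)).eq_iff.1 h
  exact ⟨W.unop.1, i.unop.le, j.unop.le, W.unop.2, hst⟩

theorem exists_germ_eq {x : X} (σ : stalk F x) :
    ∃ (U : Opens X) (hx : x ∈ U) (s : F.obj.obj (op U)), germ F hx s = σ :=
  let ⟨U, s, hs⟩ := Concrete.colimit_exists_rep ((OpenNhds.inclusion x).op ⋙ F.obj) σ
  ⟨U.unop.1, U.unop.2, s, hs⟩

theorem eq_of_germ_eq {U : Opens X} {s t : F.obj.obj (op U)}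
    (h : ∀ x (hx : x ∈ U), germ F hx s = germ F hx t) : s = t :=
  eq_of_locally_res_eq fun x hx => by
    obtain ⟨V, hV, _, hxV, hst⟩ := exists_res_eq_of_germ_eq (h x hx)
    exact ⟨V, hV, hxV, hst⟩

theorem germ_bijective {U : Opens X} {x : X} (hx : x ∈ U)
    (h : ∀ V : Opens X, x ∈ V → ∃ (W : Opens X) (hW : W ≤ U), W ≤ V ∧ x ∈ W ∧
      Function.Bijective (res F hW)) : Function.Bijective (germ F hx) := by
  refine ⟨fun s t hst => ?_, fun σ => ?_⟩
  · obtain ⟨V, hV, _, hxV, hres⟩ := exists_res_eq_of_germ_eq hst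
    obtain ⟨W, hW, hWV, -, hbij⟩ := h V hxV
    refine hbij.1 ?_
    have hres' := congrArg (res F hWV) hres
    rwa [res_res, res_res] at hres'
  · obtain ⟨V, hV, s, rfl⟩ := exists_germ_eq σ
    obtain ⟨W, hW, hWV, hxW, hbij⟩ := h V hV
    obtain ⟨r, hr⟩ := hbij.2 (res F hWV s)
    exact ⟨r, by rw [← germ_res F hW hxW, hr, germ_res]⟩

end Germ

section Point

variable {k : Type u} [Field k]

/-- The presheaf of all functions with values in `E`. -/
def functionPresheaf (X : TopCat.{0}) (E : ModuleCat.{u} k) :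
    TopCat.Presheaf (ModuleCat.{u} k) X where
  obj U := ModuleCat.of k (U.unop → E)
  map i := ModuleCat.ofHom (LinearMap.funLeft k E fun x => ⟨x.1, i.unop.le x.2⟩)

/-- The sheaf of all functions with values in `E`. -/
def functionSheaf (X : TopCat.{0}) (E : ModuleCat.{u} k) : TopCat.Sheaf (ModuleCat.{u} k) X :=
  ⟨functionPresheaf X E, (TopCat.Presheaf.isSheaf_iff_isSheaf_comp' (forget (ModuleCat.{u} k))
    (functionPresheaf X E)).2 (TopCat.Presheaf.toTypes_isSheaf X fun _ => E)⟩

theorem mem_of_map_incl {t : ℝ} {W : Opens (TopCat.of ℝ)}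
    (y : (Opens.map (incl {t})).obj W) : t ∈ W :=
  Set.mem_singleton_iff.1 y.1.2 ▸ y.2

variable (F : Sh k ℝ) (t : ℝ)

/-- The germ at `t`, as a morphism to a skyscraper sheaf. The latter is written as a direct image
from `{t}`, so that the morphism factors through `F|_{t}`. -/
def germHom : F ⟶ (TopCat.Sheaf.pushforward (ModuleCat.{u} k) (incl {t})).obj
    (functionSheaf (TopCat.of ({t} : Set ℝ)) (stalk F t)) where
  hom :=
    { app := fun W => ModuleCat.ofHom <| LinearMap.pi fun y : (Opens.map (incl {t})).obj W.unop =>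
        germ F (mem_of_map_incl y)
      naturality := fun V W i => by
        ext s
        funext y
        exact germ_res F i.unop.le (mem_of_map_incl y) s }

variable {F t}

theorem finite_stalk_of_restrict_singleton (hF : IsConstantOfFiniteRank (restrict F {t})) :
    Module.Finite k (stalk F t) := by
  let adj := inverseImageAdjunction k (incl {t})
  let β : restrict F {t} ⟶ functionSheaf (TopCat.of ({t} : Set ℝ)) (stalk F t) :=
    (adj.homEquiv _ _).symm (germHom F t)
  have hβ : adj.unit.app F ≫ (TopCat.Sheaf.pushforward (ModuleCat.{u} k) (incl {t})).map β =
      germHom F t :=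
    (adj.homEquiv_unit _ _ _).symm.trans ((adj.homEquiv _ _).apply_symm_apply _)
  have hfin : Module.Finite k ((restrict F {t}).obj.obj (op ⊤)) :=
    hF.finite (x := ⟨t, rfl⟩) Set.subsingleton_of_subsingleton.isPreconnected trivial
  let ev : (restrict F {t}).obj.obj (op ⊤) →ₗ[k] stalk F t :=
    LinearMap.proj (⟨⟨t, rfl⟩, trivial⟩ : (⊤ : Opens (TopCat.of ({t} : Set ℝ)))) ∘ₗ homApply β ⊤
  refine Module.Finite.of_surjective ev fun σ => ?_
  obtain ⟨U, hU, s, rfl⟩ := exists_germ_eq σ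
  have htop : (Opens.map (incl {t})).obj U = ⊤ := by
    ext ⟨y, rfl⟩
    exact iff_of_true hU trivial
  let r : (restrict F {t}).obj.obj (op ((Opens.map (incl {t})).obj U)) :=
    homApply (adj.unit.app F) U s
  have hr : homApply β _ r = homApply (germHom F t) U s :=
    congrArg (fun f => homApply f U s) hβ
  refine ⟨res _ htop.ge r, ?_⟩
  change homApply β ⊤ (res _ htop.ge r) ⟨⟨t, rfl⟩, trivial⟩ = _
  rw [homApply_res, hr]
  rfl

end Point

/-! ### Zigzags of vector spaces -/

section LinearRelation

variable {k E E' : Type*} [Field k] [AddCommGroup E] [Module k E] [AddCommGroup E'] [Module k E']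

theorem exists_functional_eq_one_of_notMem {A : Submodule k E} {x : E} (hx : x ∉ A) :
    ∃ φ : E →ₗ[k] k, φ x = 1 ∧ ∀ a ∈ A, φ a = 0 := by
  obtain ⟨φ, hφ, hA⟩ := Submodule.exists_le_ker_of_notMem hx
  exact ⟨(φ x)⁻¹ • φ, by simp [hφ], fun a ha => by simp [LinearMap.mem_ker.1 (hA ha)]⟩

theorem exists_functional_transport (R : Submodule k (E × E')) (φ : E →ₗ[k] k)
    (A : Submodule k E') (h : ∀ u v, (u, v) ∈ R → v ∈ A → φ u = 0) :
    ∃ ψ : E' →ₗ[k] k, (∀ u v, (u, v) ∈ R → φ u = ψ v) ∧ ∀ a ∈ A, ψ a = 0 := by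
  -- `ψ` is prescribed on the image of `L`, and the prescription `q` vanishes on the kernel of `L`.
  let L : (R × A) →ₗ[k] E' := (LinearMap.snd k E E' ∘ₗ R.subtype).coprod A.subtype
  let q : (R × A) →ₗ[k] k := (φ ∘ₗ LinearMap.fst k E E' ∘ₗ R.subtype).coprod 0
  have hq : q ∈ LinearMap.range L.dualMap := by
    rw [LinearMap.range_dualMap_eq_dualAnnihilator_ker, Submodule.mem_dualAnnihilator]
    rintro ⟨⟨⟨u, v⟩, hR⟩, a⟩ hL
    have hva : v = -a := eq_neg_of_add_eq_zero_left hL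
    have hu : φ u = 0 := h u v hR (hva ▸ A.neg_mem a.2)
    simpa [q] using hu
  obtain ⟨ψ, hψ⟩ := hq
  refine ⟨ψ, fun u v hR => ?_, fun a ha => ?_⟩
  · simpa [L, q] using (LinearMap.congr_fun hψ (⟨(u, v), hR⟩, 0)).symm
  · simpa [L, q] using LinearMap.congr_fun hψ (0, ⟨a, ha⟩)

/-- The inverse image of a subspace under a linear relation. -/
def relPreimage (R : Submodule k (E × E')) (C : Submodule k E') : Submodule k E :=
  (R ⊓ C.comap (LinearMap.snd k E E')).map (LinearMap.fst k E E')

theorem mem_relPreimage {R : Submodule k (E × E')} {C : Submodule k E'} {u : E} :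
    u ∈ relPreimage R C ↔ ∃ v ∈ C, (u, v) ∈ R := by
  constructor
  · rintro ⟨⟨u, v⟩, ⟨hR, hC⟩, rfl⟩
    exact ⟨v, hC, hR⟩
  · rintro ⟨v, hC, hR⟩
    exact ⟨(u, v), ⟨hR, hC⟩, rfl⟩

end LinearRelation

section Bar

variable {k : Type u} [Field k] {V : ℕ → Type v} [∀ i, AddCommGroup (V i)] [∀ i, Module k (V i)]
  {R : ∀ i, Submodule k (V i × V (i + 1))} {b N : ℕ} {x : ∀ i, V i} {φ : ∀ i, V i →ₗ[k] k}

/-- For a sequence of linear relations `R i` between `V i` and `V (i + 1)`: vectors and functionals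
supported on `[b, N]`, compatible with the relations there and dual to each other. The field
`boundary` says that the vectors or the functionals stay compatible across the left end. -/
structure IsBar (R : ∀ i, Submodule k (V i × V (i + 1))) (b N : ℕ) (x : ∀ i, V i)
    (φ : ∀ i, V i →ₗ[k] k) : Prop where
  le : b ≤ N
  vec_eq_zero : ∀ i ∉ Set.Icc b N, x i = 0
  functional_eq_zero : ∀ i ∉ Set.Icc b N, φ i = 0
  vec : ∀ i, b ≤ i → i < N → (x i, x (i + 1)) ∈ R i
  functional : ∀ i, b ≤ i → i < N → ∀ u v, (u, v) ∈ R i → φ i u = φ (i + 1) v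
  boundary : ∀ i, i + 1 = b → (0, x (i + 1)) ∈ R i ∨ ∀ u v, (u, v) ∈ R i → φ (i + 1) v = 0
  pairing : φ N (x N) = 1

theorem isBar_single {y : V N} {ψ : V N →ₗ[k] k} (hy : ψ y = 1)
    (h : ∀ i, i + 1 = N → (0, Pi.single N y (i + 1)) ∈ R i ∨
      ∀ u v, (u, v) ∈ R i → (Pi.single N ψ : ∀ i, V i →ₗ[k] k) (i + 1) v = 0) :
    IsBar R N N (Pi.single N y) (Pi.single N ψ) where
  le := le_rfl
  vec_eq_zero i hi := Pi.single_eq_of_ne (by rwa [Set.Icc_self] at hi) y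
  functional_eq_zero i hi :=
    Pi.single_eq_of_ne (M := fun i => V i →ₗ[k] k) (by rwa [Set.Icc_self] at hi) ψ
  vec i h₁ h₂ := (h₁.not_gt h₂).elim
  functional i h₁ h₂ := (h₁.not_gt h₂).elim
  boundary := h
  pairing := by simpa using hy

theorem IsBar.extend (h : IsBar R b N x φ) {z : V (N + 1)} {ψ : V (N + 1) →ₗ[k] k}
    (hz : (x N, z) ∈ R N) (hψ : ∀ u v, (u, v) ∈ R N → φ N u = ψ v) :
    IsBar R b (N + 1) (Function.update x (N + 1) z) (Function.update φ (N + 1) ψ) := by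
  have hb := h.le
  refine ⟨hb.trans N.le_succ, fun i hi => ?_, fun i hi => ?_, fun i hbi hi => ?_,
    fun i hbi hi => ?_, fun i hi => ?_, ?_⟩
  · rw [Set.mem_Icc] at hi
    rw [Function.update_of_ne (by lia), h.vec_eq_zero i (by rw [Set.mem_Icc]; lia)]
  · rw [Set.mem_Icc] at hi
    rw [Function.update_of_ne (by lia), h.functional_eq_zero i (by rw [Set.mem_Icc]; lia)]
  · rcases Nat.lt_succ_iff_lt_or_eq.1 hi with hi | rfl
    · simpa [hi.ne, (hi.trans N.lt_succ_self).ne] using h.vec i hbi hi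
    · simpa using hz
  · rcases Nat.lt_succ_iff_lt_or_eq.1 hi with hi | rfl
    · simpa [hi.ne, (hi.trans N.lt_succ_self).ne] using h.functional i hbi hi
    · simpa using hψ
  · have hiN : i ≠ N := by lia
    simpa [hiN] using h.boundary i hi
  · simpa [← hψ _ _ hz] using h.pairing

/-- The induction statement for the existence of bars: `A` and `B` record what has to be preserved
when the bar is continued to the right of `N`. -/
def HasBar (R : ∀ i, Submodule k (V i × V (i + 1))) (N : ℕ) (A B : Submodule k (V N)) : Prop :=
  ∃ b x φ, IsBar R b N x φ ∧ x N ∈ B ∧ ∀ a ∈ A, φ N a = 0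

theorem hasBar_of_single {A B : Submodule k (V N)} {y : V N} (hyB : y ∈ B)
    {ψ : V N →ₗ[k] k} (hy : ψ y = 1) (hψA : ∀ a ∈ A, ψ a = 0)
    (h : ∀ i, i + 1 = N → (0, Pi.single N y (i + 1)) ∈ R i ∨
      ∀ u v, (u, v) ∈ R i → (Pi.single N ψ : ∀ i, V i →ₗ[k] k) (i + 1) v = 0) :
    HasBar R N A B :=
  ⟨N, _, _, isBar_single hy h, by simpa using hyB, by simpa using hψA⟩

theorem hasBar_of_zero_rel {A B : Submodule k (V (N + 1))} {z : V (N + 1)} (hzB : z ∈ B)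
    (hzA : z ∉ A) (hz : (0, z) ∈ R N) : HasBar R (N + 1) A B := by
  obtain ⟨ψ, hψz, hψA⟩ := exists_functional_eq_one_of_notMem hzA
  refine hasBar_of_single hzB hψz hψA fun i hi => .inl ?_
  obtain rfl : i = N := by lia
  simpa using hz

theorem hasBar_of_notMem_sup_range {A B : Submodule k (V (N + 1))} {y : V (N + 1)} (hyB : y ∈ B)
    (hy : y ∉ A ⊔ (R N).map (LinearMap.snd k _ _)) : HasBar R (N + 1) A B := by
  obtain ⟨ψ, hψy, hψ⟩ := exists_functional_eq_one_of_notMem hy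
  refine hasBar_of_single hyB hψy (fun a ha => hψ a (Submodule.mem_sup_left ha)) fun i hi => .inr ?_
  obtain rfl : i = N := by lia
  intro u v huv
  simpa using hψ v (Submodule.mem_sup_right ⟨(u, v), huv, rfl⟩)

theorem hasBar_succ {A B : Submodule k (V (N + 1))}
    (h : HasBar R N (relPreimage (R N) A) (relPreimage (R N) B)) : HasBar R (N + 1) A B := by
  obtain ⟨b, x, φ, hbar, hx, hφ⟩ := h
  obtain ⟨z, hzB, hz⟩ := mem_relPreimage.1 hx
  obtain ⟨ψ, hψ, hψA⟩ := exists_functional_transport (R N) (φ N) A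
    fun u v huv hv => hφ u (mem_relPreimage.2 ⟨v, hv, huv⟩)
  exact ⟨b, _, _, hbar.extend hz hψ, by simpa using hzB, by simpa using hψA⟩

theorem hasBar (R : ∀ i, Submodule k (V i × V (i + 1))) (N : ℕ) {A B : Submodule k (V N)}
    (hAB : A < B) : HasBar R N A B := by
  induction N with
  | zero =>
    obtain ⟨y, hyB, hyA⟩ := SetLike.exists_of_lt hAB
    obtain ⟨ψ, hψy, hψA⟩ := exists_functional_eq_one_of_notMem hyA
    exact hasBar_of_single hyB hψy hψA fun i hi => (Nat.succ_ne_zero i hi).elim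
  | succ N ih =>
    by_cases hzero : ∃ z ∈ B, z ∉ A ∧ (0, z) ∈ R N
    · obtain ⟨z, hzB, hzA, hz⟩ := hzero
      exact hasBar_of_zero_rel hzB hzA hz
    push Not at hzero
    by_cases hsup : B ≤ A ⊔ (R N).map (LinearMap.snd k _ _)
    · refine hasBar_succ <| ih <|
        lt_of_le_not_ge (fun u hu => ?_) fun hle => hAB.not_ge fun y hy => ?_
      · obtain ⟨v, hv, huv⟩ := mem_relPreimage.1 hu
        exact mem_relPreimage.2 ⟨v, hAB.le hv, huv⟩
      · obtain ⟨a, ha, _, ⟨⟨u, w⟩, huw, rfl⟩, rfl⟩ := Submodule.mem_sup.1 (hsup hy)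
        change a + w ∈ B at hy
        have hw : w ∈ B := by simpa using B.sub_mem hy (hAB.le ha)
        obtain ⟨v, hv, huv⟩ := mem_relPreimage.1 (hle (mem_relPreimage.2 ⟨w, hw, huw⟩))
        have hwv : w - v ∈ A := by
          by_contra hnot
          exact hzero (w - v) (B.sub_mem hw (hAB.le hv)) hnot
            (by simpa using (R N).sub_mem huw huv)
        exact A.add_mem ha (by simpa using A.add_mem hwv hv)
    · obtain ⟨y, hyB, hy⟩ := SetLike.not_le_iff_exists.1 hsup
      exact hasBar_of_notMem_sup_range hyB hy

theorem IsBar.pairing_eq_one (h : IsBar R b N x φ) {i : ℕ} (hi : i ∈ Set.Icc b N) :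
    φ i (x i) = 1 := by
  obtain ⟨hb, hN⟩ := hi
  induction hN using Nat.decreasingInduction with
  | self => exact h.pairing
  | of_succ i hi ih => rw [h.functional i hb hi _ _ (h.vec i hb hi), ih (by lia)]

end Bar

section Zigzag

variable {k : Type u} [Field k] {V : ℕ → Type v} [∀ i, AddCommGroup (V i)] [∀ i, Module k (V i)]
  {p : ℕ → Prop} {h : ∀ i j, V i →ₗ[k] V j} {b d : ℕ} {x : ∀ i, V i} {φ : ∀ i, V i →ₗ[k] k}

/-- The arrows of the quiver of type `A` with vertex set `ℕ` in which the edge between `i` and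
`i + 1` points to the right when `p i` holds and to the left otherwise. A representation is encoded
by spaces `V i` and by linear maps between all pairs of them, of which only those along arrows
matter. -/
def Arrow (p : ℕ → Prop) (i j : ℕ) : Prop :=
  (j = i + 1 ∧ p i) ∨ (i = j + 1 ∧ ¬ p j)

/-- The linear relation between two consecutive spaces of a zigzag: the graph of the map attached
to the arrow between them. -/
def linkRel (p : ℕ → Prop) (h : ∀ i j, V i →ₗ[k] V j) (i : ℕ) : Submodule k (V i × V (i + 1)) where
  carrier := {w | (p i → h i (i + 1) w.1 = w.2) ∧ (¬ p i → h (i + 1) i w.2 = w.1)}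
  zero_mem' := by simp
  add_mem' hw hw' := by
    refine ⟨fun hp => ?_, fun hp => ?_⟩
    · simp [hw.1 hp, hw'.1 hp]
    · simp [hw.2 hp, hw'.2 hp]
  smul_mem' c w hw := by
    refine ⟨fun hp => ?_, fun hp => ?_⟩
    · simp [hw.1 hp]
    · simp [hw.2 hp]

theorem mem_linkRel_of_pos {i : ℕ} (hp : p i) {u : V i} {v : V (i + 1)} :
    (u, v) ∈ linkRel p h i ↔ h i (i + 1) u = v :=
  ⟨fun huv => huv.1 hp, fun huv => ⟨fun _ => huv, fun hn => (hn hp).elim⟩⟩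

theorem mem_linkRel_of_neg {i : ℕ} (hp : ¬ p i) {u : V i} {v : V (i + 1)} :
    (u, v) ∈ linkRel p h i ↔ h (i + 1) i v = u :=
  ⟨fun huv => huv.2 hp, fun huv => ⟨fun hn => (hp hn).elim, fun _ => huv⟩⟩

/-- A direct summand of a zigzag that is one-dimensional on `[b, d]` and zero elsewhere: the vectors
`x i` span it and the functionals `φ i` are the coordinates of a projection onto it. -/
structure IsBarSummand (p : ℕ → Prop) (h : ∀ i j, V i →ₗ[k] V j) (b d : ℕ) (x : ∀ i, V i)
    (φ : ∀ i, V i →ₗ[k] k) : Prop where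
  le : b ≤ d
  vec_eq_zero : ∀ i ∉ Set.Icc b d, x i = 0
  functional_eq_zero : ∀ i ∉ Set.Icc b d, φ i = 0
  pairing : ∀ i ∈ Set.Icc b d, φ i (x i) = 1
  vec_comp : ∀ i j, Arrow p i j → i ∈ Set.Icc b d → h i j (x i) = x j
  functional_comp : ∀ i j, Arrow p i j → j ∈ Set.Icc b d → ∀ u, φ j (h i j u) = φ i u

theorem IsBar.vec_comp (hbar : IsBar (linkRel p h) b d x φ) [Subsingleton (V (d + 1))] {i j : ℕ}
    (hij : Arrow p i j) (hi : i ∈ Set.Icc b d) : h i j (x i) = x j := by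
  obtain ⟨hbi, hid⟩ := hi
  rcases hij with ⟨rfl, hp⟩ | ⟨rfl, hp⟩
  · rcases hid.lt_or_eq with hid | rfl
    · exact (mem_linkRel_of_pos hp).1 (hbar.vec i hbi hid)
    · exact Subsingleton.elim _ _
  · rcases hbi.lt_or_eq with hbj | hbj
    · exact (mem_linkRel_of_neg hp).1 (hbar.vec j (Nat.lt_succ_iff.1 hbj) hid)
    · rw [hbar.vec_eq_zero j (by rw [Set.mem_Icc]; lia)]
      rcases hbar.boundary j hbj.symm with hvec | hfun
      · exact (mem_linkRel_of_neg hp).1 hvec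
      · have hx := hbar.pairing_eq_one ⟨hbi, hid⟩
        rw [hfun _ _ ((mem_linkRel_of_neg hp).2 rfl)] at hx
        exact (zero_ne_one hx).elim

theorem IsBar.functional_comp (hbar : IsBar (linkRel p h) b d x φ) [Subsingleton (V (d + 1))]
    {i j : ℕ} (hij : Arrow p i j) (hj : j ∈ Set.Icc b d) (u : V i) : φ j (h i j u) = φ i u := by
  obtain ⟨hbj, hjd⟩ := hj
  rcases hij with ⟨rfl, hp⟩ | ⟨rfl, hp⟩
  · rcases hbj.lt_or_eq with hbi | hbi
    · exact (hbar.functional i (Nat.lt_succ_iff.1 hbi) hjd _ _ ((mem_linkRel_of_pos hp).2 rfl)).symm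
    · rw [hbar.functional_eq_zero i (by rw [Set.mem_Icc]; lia), LinearMap.zero_apply]
      rcases hbar.boundary i hbi.symm with hvec | hfun
      · have hx := hbar.pairing_eq_one ⟨hbj, hjd⟩
        rw [← (mem_linkRel_of_pos hp).1 hvec, map_zero, map_zero] at hx
        exact (zero_ne_one hx).elim
      · exact hfun u _ ((mem_linkRel_of_pos hp).2 rfl)
  · rcases hjd.lt_or_eq with hjd | rfl
    · exact hbar.functional j hbj hjd _ _ ((mem_linkRel_of_neg hp).2 rfl)
    · simp [Subsingleton.elim u 0]

theorem IsBar.isBarSummand (hbar : IsBar (linkRel p h) b d x φ) [Subsingleton (V (d + 1))] :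
    IsBarSummand p h b d x φ where
  le := hbar.le
  vec_eq_zero := hbar.vec_eq_zero
  functional_eq_zero := hbar.functional_eq_zero
  pairing _ := hbar.pairing_eq_one
  vec_comp _ _ := hbar.vec_comp
  functional_comp _ _ := hbar.functional_comp

theorem exists_isBarSummand (p : ℕ → Prop) (h : ∀ i j, V i →ₗ[k] V j) {N : ℕ}
    (hN : ∀ i, N < i → Subsingleton (V i)) (hne : ∃ i, Nontrivial (V i)) :
    ∃ b d x φ, IsBarSummand p h b d x φ := by
  -- The bar is grown from the last nonzero space, so that it has no right end to take care of.
  have hbdd : BddAbove {i | Nontrivial (V i)} :=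
    ⟨N, fun i hi => not_lt.1 fun hlt => not_subsingleton_iff_nontrivial.2 hi (hN i hlt)⟩
  let M := sSup {i | Nontrivial (V i)}
  have : Nontrivial (V M) := Nat.sSup_mem hne hbdd
  have : Subsingleton (V (M + 1)) := not_nontrivial_iff_subsingleton.1
    fun hM => (le_csSup hbdd hM).not_gt M.lt_succ_self
  obtain ⟨b, x, φ, hbar, -, -⟩ := hasBar (linkRel p h) M (A := ⊥) (B := ⊤) bot_lt_top
  exact ⟨b, M, x, φ, hbar.isBarSummand⟩

namespace IsBarSummand

variable (hs : IsBarSummand p h b d x φ)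

include hs in
theorem functional_sub (i : ℕ) (u : V i) : φ i (u - φ i u • x i) = 0 := by
  by_cases hi : i ∈ Set.Icc b d
  · simp [hs.pairing i hi]
  · simp [hs.functional_eq_zero i hi]

/-- The projection onto the complement `i ↦ ker (φ i)` of a summand. -/
def proj (i : ℕ) : V i →ₗ[k] LinearMap.ker (φ i) :=
  (LinearMap.id - (φ i).smulRight (x i)).codRestrict _ (hs.functional_sub i)

theorem coe_proj (i : ℕ) (u : V i) : (hs.proj i u : V i) = u - φ i u • x i := rfl

theorem proj_vec (i : ℕ) : hs.proj i (x i) = 0 := by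
  ext
  by_cases hi : i ∈ Set.Icc b d
  · simp [hs.coe_proj, hs.pairing i hi]
  · simp [hs.vec_eq_zero i hi]

theorem proj_coe (i : ℕ) (w : LinearMap.ker (φ i)) : hs.proj i w = w := by
  ext
  simp [hs.coe_proj]

/-- The zigzag on the complement `i ↦ ker (φ i)` of a summand. -/
def complement (i j : ℕ) : LinearMap.ker (φ i) →ₗ[k] LinearMap.ker (φ j) :=
  hs.proj j ∘ₗ h i j ∘ₗ (LinearMap.ker (φ i)).subtype

theorem complement_proj {i j : ℕ} (hij : Arrow p i j) (u : V i) :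
    hs.complement i j (hs.proj i u) = hs.proj j (h i j u) := by
  change hs.proj j (h i j (u - φ i u • x i)) = _
  by_cases hi : i ∈ Set.Icc b d
  · rw [map_sub, map_smul, hs.vec_comp i j hij hi, map_sub, map_smul, hs.proj_vec, smul_zero,
      sub_zero]
  · simp [hs.functional_eq_zero i hi]

end IsBarSummand

/-- A decomposition of a zigzag into interval summands `[b a, d a]`, given by its coordinate
functionals. -/
structure IsBarcode {A : Type w} (p : ℕ → Prop) (h : ∀ i j, V i →ₗ[k] V j) (b d : A → ℕ)
    (φ : A → ∀ i, V i →ₗ[k] k) : Prop where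
  le : ∀ a, b a ≤ d a
  eq_zero : ∀ a, ∀ i ∉ Set.Icc (b a) (d a), φ a i = 0
  comp : ∀ a i j, Arrow p i j → j ∈ Set.Icc (b a) (d a) → ∀ u, φ a j (h i j u) = φ a i u
  injective : ∀ i u, (∀ a, φ a i u = 0) → u = 0
  surjective : ∀ i (c : A → k), (∀ a, i ∉ Set.Icc (b a) (d a) → c a = 0) → ∃ u, ∀ a, φ a i u = c a

theorem IsBarSummand.isBarcode_option (hs : IsBarSummand p h b d x φ) {A : Type w} {b' d' : A → ℕ}
    {ψ : A → ∀ i, LinearMap.ker (φ i) →ₗ[k] k} (hψ : IsBarcode p hs.complement b' d' ψ) :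
    IsBarcode p h (fun a : Option A => a.elim b b') (fun a => a.elim d d')
      (fun a => a.elim φ fun a i => ψ a i ∘ₗ hs.proj i) where
  le := by
    rintro (_ | a)
    exacts [hs.le, hψ.le a]
  eq_zero := by
    rintro (_ | a) i hi
    · exact hs.functional_eq_zero i hi
    · change ψ a i ∘ₗ hs.proj i = 0
      rw [hψ.eq_zero a i hi, LinearMap.zero_comp]
  comp := by
    rintro (_ | a) i j hij hj u
    · exact hs.functional_comp i j hij hj u
    · change ψ a j (hs.proj j (h i j u)) = ψ a i (hs.proj i u)
      rw [← hs.complement_proj hij, hψ.comp a i j hij hj]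
  injective i u hu := by
    have hproj : hs.proj i u = 0 := hψ.injective i _ fun a => hu (some a)
    have hφ : φ i u = 0 := hu none
    simpa [hproj, hφ] using (hs.coe_proj i u).symm
  surjective i c hc := by
    obtain ⟨w, hw⟩ := hψ.surjective i (fun a => c (some a)) fun a => hc (some a)
    refine ⟨w + c none • x i, ?_⟩
    rintro (_ | a)
    · change φ i (w + c none • x i) = c none
      rw [map_add, LinearMap.mem_ker.1 w.2, zero_add, map_smul]
      by_cases hi : i ∈ Set.Icc b d
      · simp [hs.pairing i hi]
      · simp [hc none hi]
    · change ψ a i (hs.proj i (w + c none • x i)) = c (some a)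
      rw [map_add, map_smul, hs.proj_vec, hs.proj_coe, smul_zero, add_zero, hw]

theorem IsBarSummand.sum_finrank_ker_lt [∀ i, Module.Finite k (V i)]
    (hs : IsBarSummand p h b d x φ) {s : Finset ℕ} (hd : d ∈ s) :
    ∑ i ∈ s, Module.finrank k (LinearMap.ker (φ i)) < ∑ i ∈ s, Module.finrank k (V i) := by
  refine Finset.sum_lt_sum (fun i _ => Submodule.finrank_le _) ⟨d, hd, Submodule.finrank_lt ?_⟩
  intro htop
  have hx := hs.pairing d ⟨hs.le, le_rfl⟩
  rw [LinearMap.mem_ker.1 (htop ▸ Submodule.mem_top : x d ∈ LinearMap.ker (φ d))] at hx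
  exact zero_ne_one hx

theorem exists_isBarcode (p : ℕ → Prop) {V : ℕ → Type v} [∀ i, AddCommGroup (V i)]
    [∀ i, Module k (V i)] (h : ∀ i j, V i →ₗ[k] V j) [∀ i, Module.Finite k (V i)] {N : ℕ}
    (hN : ∀ i, N < i → Subsingleton (V i)) :
    ∃ (A : Type) (_ : Finite A) (b d : A → ℕ) (φ : A → ∀ i, V i →ₗ[k] k),
      IsBarcode p h b d φ := by
  induction hn : ∑ i ∈ Finset.range (N + 1), Module.finrank k (V i)
    using Nat.strong_induction_on generalizing V with
  | _ n ih =>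
  by_cases hne : ∃ i, Nontrivial (V i)
  · obtain ⟨b, d, x, φ, hs⟩ := exists_isBarSummand p h hN hne
    have hd : d ∈ Finset.range (N + 1) := by
      by_contra hd
      have := hN d (by simpa using hd)
      have hx := hs.pairing d ⟨hs.le, le_rfl⟩
      rw [Subsingleton.elim (x d) 0, map_zero] at hx
      exact zero_ne_one hx
    obtain ⟨A, hA, b', d', ψ, hψ⟩ := ih _ (hn ▸ hs.sum_finrank_ker_lt hd) hs.complement
      (fun i hi => by have := hN i hi; infer_instance) rfl
    exact ⟨Option A, inferInstance, _, _, _, hs.isBarcode_option hψ⟩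
  · have hV : ∀ i, Subsingleton (V i) := by simpa [not_nontrivial_iff_subsingleton] using hne
    exact ⟨Empty, inferInstance, Empty.elim, Empty.elim, fun a => a.elim,
      fun a => a.elim, fun a => a.elim, fun a => a.elim, fun i u _ => Subsingleton.elim _ _,
      fun i c _ => ⟨0, fun a => a.elim⟩⟩

end Zigzag

/-! ### Stratifications of `ℝ` with finitely many strata -/

/-- `j` numbers the strata of a stratification of `ℝ` from left to right: the strata of odd index
are points and those of even index are open intervals. -/
structure IsStratumIndex (j : ℝ → ℕ) : Prop where
  mono : Monotone j
  even : ∀ y, Even (j y) → ∀ᶠ z in 𝓝 y, j z = j y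
  odd : ∀ y, Odd (j y) → ∀ᶠ z in 𝓝 y, (z < y → j z + 1 = j y) ∧ (y < z → j z = j y + 1)

/-- The union of the strata whose closure meets the stratum of index `m`; it is empty if there is
no such stratum. -/
def starSet (j : ℝ → ℕ) (m : ℕ) : Set ℝ :=
  {y | m ∈ Set.range j ∧ (j y = m ∨ Odd m ∧ (j y + 1 = m ∨ j y = m + 1))}

namespace IsStratumIndex

variable {j : ℝ → ℕ} (hj : IsStratumIndex j)
include hj

theorem lt_of_odd {y z : ℝ} (hyz : y < z) (h : Odd (j y) ∨ Odd (j z)) : j y < j z := by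
  rcases h with h | h
  · obtain ⟨w, hw, hyw, hwz⟩ := (((hj.odd y h).filter_mono nhdsWithin_le_nhds).and
      (Ioo_mem_nhdsGT hyz)).exists
    exact (Nat.lt_of_succ_le (hw.2 hyw).ge).trans_le (hj.mono hwz.le)
  · obtain ⟨w, hw, hyw, hwz⟩ := (((hj.odd z h).filter_mono nhdsWithin_le_nhds).and
      (Ioo_mem_nhdsLT hyz)).exists
    exact (hj.mono hyw.le).trans_lt (Nat.lt_of_succ_le (hw.1 hwz).le)

theorem isOpen_starSet (m : ℕ) : IsOpen (starSet j m) := by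
  rw [isOpen_iff_eventually]
  rintro y ⟨hm, hy⟩
  rcases Nat.even_or_odd (j y) with h | h
  · filter_upwards [hj.even y h] with z hz
    exact ⟨hm, hz.symm ▸ hy⟩
  · obtain rfl : j y = m := by grind
    filter_upwards [hj.odd y h] with z hz
    refine ⟨hm, ?_⟩
    rcases lt_trichotomy z y with h' | rfl | h'
    exacts [.inr ⟨h, .inl (hz.1 h')⟩, .inl rfl, .inr ⟨h, .inr (hz.2 h')⟩]

/-- The open star of the stratum of index `m`. -/
def star (m : ℕ) : Opens (TopCat.of ℝ) := ⟨starSet j m, hj.isOpen_starSet m⟩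

theorem mem_star {m : ℕ} {y : ℝ} : y ∈ hj.star m ↔
    m ∈ Set.range j ∧ (j y = m ∨ Odd m ∧ (j y + 1 = m ∨ j y = m + 1)) := Iff.rfl

theorem self_mem_star (y : ℝ) : y ∈ hj.star (j y) := ⟨⟨y, rfl⟩, .inl rfl⟩

theorem arrow_of_mem_star {m : ℕ} {y : ℝ} (hy : y ∈ hj.star m) : j y = m ∨ Arrow Odd m (j y) := by
  obtain ⟨-, h⟩ := hj.mem_star.1 hy
  unfold Arrow
  grind

theorem star_le_star {m : ℕ} {y : ℝ} (hy : y ∈ hj.star m) : hj.star (j y) ≤ hj.star m := by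
  rintro z ⟨-, hz⟩
  obtain ⟨hm, hy⟩ := hj.mem_star.1 hy
  exact ⟨hm, by grind⟩

theorem ordConnected_star (m : ℕ) : (hj.star m : Set ℝ).OrdConnected := by
  refine ⟨?_⟩
  rintro x ⟨hm, hx⟩ y ⟨-, hy⟩ z hz
  have hxz := hj.mono hz.1
  have hzy := hj.mono hz.2
  exact ⟨hm, by grind⟩

theorem isInterval_star (y : ℝ) : IsInterval (hj.star (j y) : Set ℝ) :=
  ⟨⟨y, hj.self_mem_star y⟩, hj.ordConnected_star _⟩

theorem even_of_mem_star {x y : ℝ} (hy : y ∈ hj.star (j x)) (hxy : y ≠ x) : Even (j y) := by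
  by_contra hodd
  rw [Nat.not_even_iff_odd] at hodd
  have hne : j y ≠ j x := by
    rcases hxy.lt_or_gt with h | h
    · exact (hj.lt_of_odd h (.inl hodd)).ne
    · exact (hj.lt_of_odd h (.inr hodd)).ne'
  have := (hj.mem_star.1 hy).2
  grind

end IsStratumIndex

theorem exists_isInterval_nhds {U : Opens (TopCat.of ℝ)} {y : ℝ} (hy : y ∈ U) :
    ∃ W ≤ U, y ∈ W ∧ IsInterval (W : Set ℝ) := by
  obtain ⟨ε, hε, h⟩ := Metric.isOpen_iff.1 U.isOpen y hy
  rw [Real.ball_eq_Ioo] at h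
  have hyW : y ∈ Set.Ioo (y - ε) (y + ε) := by constructor <;> linarith
  exact ⟨⟨Set.Ioo (y - ε) (y + ε), isOpen_Ioo⟩, h, hyW, ⟨y, hyW⟩, Set.ordConnected_Ioo⟩

section FiniteSet

variable (T : Finset ℝ)

/-- The stratum index of the stratification of `ℝ` defined by a finite set of points: points of `T`
get odd values, the intervals between them even ones. -/
def stratumIndex (y : ℝ) : ℕ := (T.filter (· < y)).card + (T.filter (· ≤ y)).card

theorem stratumIndex_mono : Monotone (stratumIndex T) := by
  intro y z h
  unfold stratumIndex
  gcongr

theorem stratumIndex_le (y : ℝ) : stratumIndex T y ≤ T.card + T.card :=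
  add_le_add (Finset.card_filter_le _ _) (Finset.card_filter_le _ _)

variable {T} {y : ℝ}

theorem filter_le_eq_of_notMem (hy : y ∉ T) : T.filter (· ≤ y) = T.filter (· < y) :=
  Finset.filter_congr fun _ ht =>
    ⟨fun h => lt_of_le_of_ne h fun h' => hy (h' ▸ ht), le_of_lt⟩

theorem card_filter_le_of_mem (hy : y ∈ T) :
    (T.filter (· ≤ y)).card = (T.filter (· < y)).card + 1 := by
  have : T.filter (· ≤ y) = insert y (T.filter (· < y)) := by
    ext t
    simp only [Finset.mem_filter, Finset.mem_insert]
    grind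
  rw [this, Finset.card_insert_of_notMem (by simp)]

theorem odd_stratumIndex_iff : Odd (stratumIndex T y) ↔ y ∈ T := by
  by_cases hy : y ∈ T
  · simp [stratumIndex, card_filter_le_of_mem hy, hy, ← add_assoc, ← two_mul]
  · simp [stratumIndex, filter_le_eq_of_notMem hy, hy, ← two_mul]

variable (T y) in
theorem eventually_filter_eq : ∀ᶠ z in 𝓝 y,
    (z < y → T.filter (· < z) = T.filter (· < y) ∧ T.filter (· ≤ z) = T.filter (· < y)) ∧
      (y < z → T.filter (· < z) = T.filter (· ≤ y) ∧ T.filter (· ≤ z) = T.filter (· ≤ y)) := by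
  have hT : ∀ᶠ z in 𝓝 y, ∀ t ∈ T, (t < y → t < z) ∧ (y < t → z < t) := by
    rw [Filter.eventually_all_finset]
    intro t _
    rcases lt_trichotomy t y with h | rfl | h
    · filter_upwards [lt_mem_nhds h] with z hz using ⟨fun _ => hz, fun h' => (h.asymm h').elim⟩
    · exact .of_forall fun z => ⟨fun h => (lt_irrefl _ h).elim, fun h => (lt_irrefl _ h).elim⟩
    · filter_upwards [gt_mem_nhds h] with z hz using ⟨fun h' => (h.asymm h').elim, fun _ => hz⟩
  filter_upwards [hT] with z hz
  refine ⟨fun hzy => ⟨?_, ?_⟩, fun hyz => ⟨?_, ?_⟩⟩ <;>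
    exact Finset.filter_congr (by grind)

theorem isStratumIndex_stratumIndex : IsStratumIndex (stratumIndex T) where
  mono := stratumIndex_mono T
  even y hy := by
    have hyT : y ∉ T := by rwa [← odd_stratumIndex_iff, Nat.not_odd_iff_even]
    filter_upwards [eventually_filter_eq T y] with z hz
    unfold stratumIndex
    rw [filter_le_eq_of_notMem hyT] at hz ⊢
    rcases lt_trichotomy z y with h | rfl | h
    · rw [(hz.1 h).1, (hz.1 h).2]
    · rw [filter_le_eq_of_notMem hyT]
    · rw [(hz.2 h).1, (hz.2 h).2]
  odd y hy := by
    have hcard := card_filter_le_of_mem (odd_stratumIndex_iff.1 hy)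
    filter_upwards [eventually_filter_eq T y] with z hz
    unfold stratumIndex
    refine ⟨fun h => ?_, fun h => ?_⟩
    · rw [(hz.1 h).1, (hz.1 h).2, hcard, add_assoc]
    · rw [(hz.2 h).1, (hz.2 h).2, hcard]
      ring

end FiniteSet

/-! ### Sheaves with coordinates on the stalks -/

section StalkCoordinates

variable {k : Type u} [Field k]

theorem eq_of_homApply_biproduct_π_eq {X : TopCat.{0}} {A : Type w} [Finite A]
    {G : A → TopCat.Sheaf (ModuleCat.{u} k) X} [HasBiproduct G] {U : Opens X}
    {s t : (⨁ G).obj.obj (op U)}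
    (h : ∀ a, homApply (biproduct.π G a) U s = homApply (biproduct.π G a) U t) : s = t := by
  cases nonempty_fintype A
  have hsum (r : (⨁ G).obj.obj (op U)) :
      r = ∑ a, homApply (biproduct.ι G a) U (homApply (biproduct.π G a) U r) := by
    simp only [← homApply_comp, ← homApply_sum]
    exact congrArg (homApply · U r) (IsBilimit.total (biproduct.isBilimit G)).symm
  rw [hsum s, hsum t]
  simp only [h]

open Classical in
/-- Functionals on the stalks of `F` that turn the sections of `F` into sections of `k_I`. -/
def IsStalkCoordinate (F : Sh k ℝ) (I : Set ℝ) (ψ : ∀ y : ℝ, stalk F y →ₗ[k] k) : Prop :=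
  ∀ (U : Opens (TopCat.of ℝ)) (s : F.obj.obj (op U)) (y : U),
    ∀ᶠ z : U in 𝓝 y, ψ z.1 (germ F z.2 s) = if z.1 ∈ I then ψ y.1 (germ F y.2 s) else 0

namespace IsStalkCoordinate

variable {F : Sh k ℝ} {I : Set ℝ} {ψ : ∀ y : ℝ, stalk F y →ₗ[k] k} (hψ : IsStalkCoordinate F I ψ)
include hψ

theorem isExtSection {U : Opens (TopCat.of ℝ)} (s : F.obj.obj (op U)) :
    IsExtSection I fun y : U => ψ y.1 (germ F y.2 s) := by
  rw [isExtSection_iff]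
  refine ⟨fun y hy => ?_, fun y _ => ?_, fun y hy => ?_⟩
  · rw [(hψ U s y).self_of_nhds, if_neg hy]
  · filter_upwards [hψ U s y] with z hz hzI
    rw [hz, if_pos hzI]
  · filter_upwards [hψ U s y] with z hz
    rw [hz, hy, ite_self]

/-- The morphism to `k_I` given by functionals on the stalks. -/
def hom : F ⟶ kSheaf k I where
  hom :=
    { app := fun U => ModuleCat.ofHom
        { toFun := fun s => ⟨fun y => ψ y.1 (germ F y.2 s), hψ.isExtSection s⟩
          map_add' := fun s t => Subtype.ext (funext fun y => by simp)
          map_smul' := fun c s => Subtype.ext (funext fun y => by simp) }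
      naturality := fun U V i => by
        ext s
        exact Subtype.ext (funext fun y => congrArg _ (germ_res F i.unop.le y.2 s)) }

theorem homApply_hom_apply {U : Opens (TopCat.of ℝ)} (s : F.obj.obj (op U)) (y : U) :
    (homApply hψ.hom U s).1 y = ψ y.1 (germ F y.2 s) :=
  rfl

end IsStalkCoordinate

theorem isIso_lift_stalkCoordinates {F : Sh k ℝ} {A : Type w} [Finite A] {I : A → Set ℝ}
    {ψ : ∀ (_ : A) (y : ℝ), stalk F y →ₗ[k] k} (hψ : ∀ a, IsStalkCoordinate F (I a) (ψ a))
    (hinj : ∀ (y : ℝ) (σ : stalk F y), (∀ a, ψ a y σ = 0) → σ = 0)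
    (hsurj : ∀ (y : ℝ) (c : A → k), (∀ a, y ∉ I a → c a = 0) →
      ∃ σ : stalk F y, ∀ a, ψ a y σ = c a) :
    IsIso (biproduct.lift fun a => (hψ a).hom) := by
  have hlift (a : A) {U : Opens (TopCat.of ℝ)} (s : F.obj.obj (op U)) :
      homApply (biproduct.π (fun a => kSheaf k (I a)) a) U
        (homApply (biproduct.lift fun a => (hψ a).hom) U s) = homApply (hψ a).hom U s := by
    rw [← homApply_comp, biproduct.lift_π]
  refine isIso_of_locally_bijective _ (fun U s hs => ?_) (fun U t x hx => ?_)
  · refine eq_of_germ_eq fun y hy => ?_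
    rw [map_zero]
    refine hinj y _ fun a => ?_
    rw [← (hψ a).homApply_hom_apply s ⟨y, hy⟩, ← hlift, hs, map_zero]
    rfl
  · let c (a : A) : extSections k (I a) U := homApply (biproduct.π _ a) U t
    obtain ⟨σ, hσ⟩ := hsurj x (fun a => (c a).1 ⟨x, hx⟩) fun a ha => (c a).2.1 ⟨x, hx⟩ ha
    obtain ⟨V, hxV, s, rfl⟩ := exists_germ_eq σ
    let s' : F.obj.obj (op (U ⊓ V)) := res F inf_le_right s
    let e (a : A) : extSections k (I a) (U ⊓ V) :=
      homApply (hψ a).hom (U ⊓ V) s' - res (kSheaf k (I a)) inf_le_left (c a)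
    have he (a : A) : (e a).1 ⟨x, hx, hxV⟩ = 0 := by
      change ψ a x (germ F _ s') - (c a).1 ⟨x, hx⟩ = 0
      rw [germ_res, hσ, sub_self]
    obtain ⟨W, hW, hxW, heW⟩ := exists_le_of_eventually _ <| Filter.eventually_all.2 fun a =>
      ((isExtSection_iff _ _).1 (e a).2).2.2 _ (he a)
    refine ⟨W, hW.trans inf_le_left, hxW, res F hW s', ?_⟩
    refine eq_of_homApply_biproduct_π_eq fun a => ?_
    rw [hlift, homApply_res (hψ a).hom hW s', homApply_res (biproduct.π _ a)]
    exact Subtype.ext (funext fun y => sub_eq_zero.1 (heW y.1 y.2 a))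

end StalkCoordinates

/-! ### Sheaves adapted to a finite stratification -/

section Adapted

variable {k : Type u} [Field k] {F : Sh k ℝ} {j : ℝ → ℕ} {hj : IsStratumIndex j}

/-- The sections of `F` over the open star of a stratum are the germs at any point of the stratum,
and they form a finite dimensional space. -/
structure IsAdapted (F : Sh k ℝ) (hj : IsStratumIndex j) : Prop where
  bijective_germ : ∀ y, Function.Bijective (germ F (hj.self_mem_star y))
  finite : ∀ y, Module.Finite k (F.obj.obj (op (hj.star (j y))))

open Classical in
/-- The restriction map between the sections over two stars, set to zero where the stars are not
nested. -/
def starMap (F : Sh k ℝ) (hj : IsStratumIndex j) (m n : ℕ) :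
    F.obj.obj (op (hj.star m)) →ₗ[k] F.obj.obj (op (hj.star n)) :=
  if h : hj.star n ≤ hj.star m then res F h else 0

theorem subsingleton_sections_star (F : Sh k ℝ) (hj : IsStratumIndex j) {m : ℕ}
    (hm : m ∉ Set.range j) : Subsingleton (F.obj.obj (op (hj.star m))) :=
  ⟨fun _ _ => eq_of_locally_res_eq fun _ hy => (hm hy.1).elim⟩

open Classical in
theorem IsBarcode.apply_res_star {A : Type w} {b d : A → ℕ}
    {φ : A → ∀ i, F.obj.obj (op (hj.star i)) →ₗ[k] k} (hφ : IsBarcode Odd (starMap F hj) b d φ)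
    (a : A) {m : ℕ} {z : ℝ} (hz : z ∈ hj.star m) (σ : F.obj.obj (op (hj.star m))) :
    φ a (j z) (res F (hj.star_le_star hz) σ) =
      if z ∈ j ⁻¹' Set.Icc (b a) (d a) then φ a m σ else 0 := by
  split_ifs with hI
  · suffices ∀ n (hle : hj.star n ≤ hj.star m), n ∈ Set.Icc (b a) (d a) →
        n = m ∨ Arrow Odd m n → φ a n (res F hle σ) = φ a m σ from
      this _ (hj.star_le_star hz) hI (hj.arrow_of_mem_star hz)
    rintro n hle hn (rfl | hmn)
    · rw [res_self]
    · rw [← hφ.comp a m n hmn hn, starMap, dif_pos hle]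
  · rw [hφ.eq_zero a _ hI, LinearMap.zero_apply]

namespace IsAdapted

variable (hF : IsAdapted F hj)

/-- The sections over the star of a stratum as the stalk at a point of the stratum. -/
def germEquiv (y : ℝ) : F.obj.obj (op (hj.star (j y))) ≃ₗ[k] stalk F y :=
  .ofBijective _ (hF.bijective_germ y)

theorem germEquiv_symm_germ_star {m : ℕ} {z : ℝ} (hz : z ∈ hj.star m)
    (σ : F.obj.obj (op (hj.star m))) :
    (hF.germEquiv z).symm (germ F hz σ) = res F (hj.star_le_star hz) σ := by
  rw [LinearEquiv.symm_apply_eq]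
  exact (germ_res F (hj.star_le_star hz) (hj.self_mem_star z) σ).symm

theorem isStalkCoordinate {A : Type w} {b d : A → ℕ}
    {φ : A → ∀ i, F.obj.obj (op (hj.star i)) →ₗ[k] k} (hφ : IsBarcode Odd (starMap F hj) b d φ)
    (a : A) : IsStalkCoordinate F (j ⁻¹' Set.Icc (b a) (d a))
      fun y => φ a (j y) ∘ₗ (hF.germEquiv y).symm := by
  intro U s y
  obtain ⟨σ, hσ⟩ := (hF.bijective_germ y.1).2 (germ F y.2 s)
  obtain ⟨W, hWstar, hWU, hyW, hres⟩ := exists_res_eq_of_germ_eq hσ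
  filter_upwards [(W.isOpen.preimage continuous_subtype_val).mem_nhds hyW] with z hz
  have hgerm : germ F z.2 s = germ F (hWstar hz) σ := by
    rw [← germ_res F hWU hz, ← hres, germ_res]
  simp only [LinearMap.comp_apply, LinearEquiv.coe_coe]
  rw [hgerm, ← hσ, hF.germEquiv_symm_germ_star, hφ.apply_res_star a (hWstar hz),
    show (hF.germEquiv y.1).symm (germ F (hj.self_mem_star y.1) σ) = σ from
      (hF.germEquiv y.1).symm_apply_apply σ]

include hF in
theorem finite_sections_star (m : ℕ) : Module.Finite k (F.obj.obj (op (hj.star m))) := by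
  by_cases hm : m ∈ Set.range j
  · obtain ⟨y, rfl⟩ := hm
    exact hF.finite y
  · have := subsingleton_sections_star F hj hm
    infer_instance

include hF in
theorem exists_iso {N : ℕ} (hN : ∀ y, j y ≤ N) :
    ∃ (A : Type) (_ : Finite A) (I : A → Set ℝ), (∀ a, IsInterval (I a)) ∧
      Nonempty (F ≅ ⨁ fun a => kSheaf k (I a)) := by
  have := hF.finite_sections_star
  obtain ⟨A, hA, b, d, φ, hφ⟩ := exists_isBarcode Odd (starMap F hj) (N := N) fun i hi =>
    subsingleton_sections_star F hj (by rintro ⟨y, rfl⟩; exact (hN y).not_gt hi)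
  have hiso := isIso_lift_stalkCoordinates (hF.isStalkCoordinate hφ)
    (fun y σ hσ => (hF.germEquiv y).symm.map_eq_zero_iff.1 (hφ.injective _ _ hσ))
    fun y c hc => by
      obtain ⟨u, hu⟩ := hφ.surjective (j y) c hc
      exact ⟨hF.germEquiv y u, fun a => by simpa using hu a⟩
  refine ⟨A, hA, _, fun a => ⟨?_, Set.ordConnected_Icc.preimage_mono hj.mono⟩,
    ⟨@asIso _ _ _ _ _ hiso⟩⟩
  classical
  by_contra hempty
  have := subsingleton_sections_star F hj (m := b a) fun ⟨y, hy⟩ =>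
    hempty ⟨y, hy.ge, hy.trans_le (hφ.le a)⟩
  obtain ⟨u, hu⟩ := hφ.surjective (b a) (Pi.single a 1) fun a' ha' =>
    Pi.single_eq_of_ne (by rintro rfl; exact ha' ⟨le_rfl, hφ.le _⟩) _
  simpa [Subsingleton.elim u 0] using hu a

end IsAdapted

/-! ### Sheaves constant off a finite set -/

theorem nonempty_inf_Iio {W : Opens (TopCat.of ℝ)} {x : ℝ} (hx : x ∈ W) :
    ((W : Set ℝ) ∩ Set.Iio x).Nonempty :=
  mem_closure_iff.1 (by simp : x ∈ closure (Set.Iio x)) W W.isOpen hx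

theorem nonempty_inf_Ioi {W : Opens (TopCat.of ℝ)} {x : ℝ} (hx : x ∈ W) :
    ((W : Set ℝ) ∩ Set.Ioi x).Nonempty :=
  mem_closure_iff.1 (by simp : x ∈ closure (Set.Ioi x)) W W.isOpen hx

theorem bijective_res_of_isConstOn_sides {U W : Opens (TopCat.of ℝ)} (hWU : W ≤ U)
    (hU : (U : Set ℝ).OrdConnected) (hW : (W : Set ℝ).OrdConnected) {x : ℝ} (hx : x ∈ W)
    (hl : IsConstOn F (U ∩ Set.Iio x)) (hr : IsConstOn F (U ∩ Set.Ioi x)) :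
    Function.Bijective (res F hWU) := by
  let L : Opens (TopCat.of ℝ) := U ⊓ ⟨Set.Iio x, isOpen_Iio⟩
  let R : Opens (TopCat.of ℝ) := U ⊓ ⟨Set.Ioi x, isOpen_Ioi⟩
  obtain ⟨y, hyW, hyx⟩ := nonempty_inf_Iio hx
  obtain ⟨z, hzW, hzx⟩ := nonempty_inf_Ioi hx
  have hcL : (L : Set ℝ).OrdConnected := hU.inter Set.ordConnected_Iio
  have hcR : (R : Set ℝ).OrdConnected := hU.inter Set.ordConnected_Ioi
  have hRW : R ⊓ (L ⊔ W) = R ⊓ W := by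
    refine le_antisymm ?_ (inf_le_inf le_rfl le_sup_right)
    rintro v ⟨hvR, hvL | hvW⟩
    · exact (lt_asymm (show v < x from hvL.2) hvR.2).elim
    · exact ⟨hvR, hvW⟩
  have hbijL : Function.Bijective (res F (inf_le_left : L ⊓ W ≤ L)) :=
    hl.bijective_res _ subset_rfl ⟨⟨y, hWU hyW, hyx⟩, hcL⟩ ⟨⟨y, ⟨hWU hyW, hyx⟩, hyW⟩, hcL.inter hW⟩
  have hbijR : Function.Bijective (res F (inf_le_left : R ⊓ (L ⊔ W) ≤ R)) :=
    hr.bijective_res _ subset_rfl ⟨⟨z, hWU hzW, hzx⟩, hcR⟩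
      (hRW ▸ ⟨⟨z, ⟨hWU hzW, hzx⟩, hzW⟩, hcR.inter hW⟩)
  have hLW : L ⊔ W ≤ U := sup_le inf_le_left hWU
  have hUR : U ≤ R ⊔ (L ⊔ W) := fun v hv => by
    rcases lt_trichotomy v x with hvx | rfl | hvx
    exacts [.inr (.inl ⟨hv, hvx⟩), .inr (.inr hx), .inl ⟨hv, hvx⟩]
  have hcomp : ⇑(res F (le_sup_right : W ≤ L ⊔ W)) ∘ res F hLW = res F hWU :=
    funext (res_res F hLW le_sup_right)
  rw [← hcomp]
  exact (bijective_res_of_le_sup le_sup_left le_sup_right le_rfl hbijL).comp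
    (bijective_res_of_le_sup inf_le_left hLW hUR hbijR)

variable (hj) in
theorem isAdapted_of_isConstOn
    (hconst : ∀ O : Opens (TopCat.of ℝ), (O : Set ℝ).OrdConnected → (∀ y ∈ O, Even (j y)) →
      IsConstOn F O)
    (hfin : ∀ y, Odd (j y) → Module.Finite k (stalk F y)) : IsAdapted F hj := by
  have hbij (y : ℝ) : Function.Bijective (germ F (hj.self_mem_star y)) := by
    have hstar := hj.ordConnected_star (j y)
    refine germ_bijective _ fun V hyV => ?_
    obtain ⟨W, hW, hyW, -, hWc⟩ := exists_isInterval_nhds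
      (show y ∈ hj.star (j y) ⊓ V from ⟨hj.self_mem_star y, hyV⟩)
    refine ⟨W, hW.trans inf_le_left, hW.trans inf_le_right, hyW,
      bijective_res_of_isConstOn_sides _ hstar hWc hyW ?_ ?_⟩
    · exact hconst (hj.star (j y) ⊓ ⟨Set.Iio y, isOpen_Iio⟩) (hstar.inter Set.ordConnected_Iio)
        fun z hz => hj.even_of_mem_star hz.1 hz.2.ne
    · exact hconst (hj.star (j y) ⊓ ⟨Set.Ioi y, isOpen_Ioi⟩) (hstar.inter Set.ordConnected_Ioi)
        fun z hz => hj.even_of_mem_star hz.1 hz.2.ne'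
  refine ⟨hbij, fun y => ?_⟩
  rcases Nat.even_or_odd (j y) with hy | hy
  · refine (hconst _ (hj.ordConnected_star _) fun z hz => ?_).finite _ subset_rfl
      (hj.isInterval_star y)
    rcases eq_or_ne z y with rfl | hzy
    exacts [hy, hj.even_of_mem_star hz hzy]
  · have := hfin y hy
    exact Module.Finite.equiv (LinearEquiv.ofBijective _ (hbij y)).symm

end Adapted

/-! ### Constructible sheaves -/

theorem IsAnalyticSubmanifold.isOpen_of_nontrivial {S : Set ℝ} (hS : IsAnalyticSubmanifold S)
    (hc : _root_.IsPreconnected S) (hnt : S.Nontrivial) : IsOpen S := by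
  refine isOpen_iff_mem_nhds.2 fun x hx => ?_
  obtain ⟨φ, -, hxφ, W, hW⟩ := hS x hx
  have hmem {y : ℝ} (hy : y ∈ φ.source) : y ∈ S ↔ φ y ∈ W := by
    simpa [hy] using Set.ext_iff.1 hW y
  have hnhds : φ.source ∈ 𝓝 x := φ.open_source.mem_nhds hxφ
  rcases eq_bot_or_eq_top W with rfl | rfl
  · obtain ⟨y, ⟨hyφ, hyS⟩, hyx⟩ := accPt_iff_nhds.1 (hc.preperfect_of_nontrivial hnt x hx) _ hnhds
    have hφy : φ y = 0 := (hmem hyφ).1 hyS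
    have hφx : φ x = 0 := (hmem hxφ).1 hx
    exact (hyx (φ.injOn hyφ hxφ (hφy.trans hφx.symm))).elim
  · exact Filter.mem_of_superset hnhds fun y hy => (hmem hy).2 trivial

theorem IsAnalyticStratification.isOpen_or_eq_singleton {𝒮 : Set (Set ℝ)}
    (h𝒮 : IsAnalyticStratification 𝒮) {S : Set ℝ} (hS : S ∈ 𝒮) : IsOpen S ∨ ∃ x, S = {x} := by
  have hc := h𝒮.connected S hS
  rcases hc.nonempty.exists_eq_singleton_or_nontrivial with hx | hnt
  exacts [.inr hx, .inl ((h𝒮.submanifold S hS).isOpen_of_nontrivial hc.isPreconnected hnt)]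

theorem IsAnalyticStratification.finite_point_strata {𝒮 : Set (Set ℝ)}
    (h𝒮 : IsAnalyticStratification 𝒮) {K : Set ℝ} (hK : IsCompact K) :
    {t ∈ K | {t} ∈ 𝒮}.Finite := by
  refine Set.Finite.of_finite_image (f := fun t : ℝ => ({t} : Set ℝ))
    (((h𝒮.locallyFinite.finite_nonempty_inter_compact hK).image Subtype.val).subset ?_)
    Set.singleton_injective.injOn
  rintro _ ⟨t, ⟨ht, htS⟩, rfl⟩
  exact ⟨⟨{t}, htS⟩, ⟨t, rfl, ht⟩, rfl⟩

section Support

variable {k : Type u} [Field k] {F : Sh k ℝ}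

theorem notMem_supp_iff {x : ℝ} : x ∉ supp F ↔
    ∃ U : Opens (TopCat.of ℝ), x ∈ U ∧ ∀ V ≤ U, Subsingleton (F.obj.obj (op V)) := by
  rw [supp, Set.notMem_compl_iff]
  simp only [Set.mem_iUnion, Set.mem_ofPred_eq, ModuleCat.isZero_iff_subsingleton, exists_prop]
  exact exists_congr fun U => and_comm

theorem isClosed_supp : IsClosed (supp F) :=
  ⟨by
    rw [supp, compl_compl]
    exact isOpen_biUnion fun U _ => U.isOpen⟩

theorem subsingleton_of_disjoint_supp {U : Opens (TopCat.of ℝ)}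
    (hU : Disjoint (U : Set ℝ) (supp F)) : Subsingleton (F.obj.obj (op U)) := by
  refine ⟨fun s t => eq_of_locally_res_eq fun x hx => ?_⟩
  obtain ⟨O, hxO, hO⟩ := notMem_supp_iff.1 (Set.disjoint_left.1 hU hx)
  have := hO (U ⊓ O) inf_le_right
  exact ⟨U ⊓ O, inf_le_left, ⟨hx, hxO⟩, Subsingleton.elim _ _⟩

theorem isConstOn_of_disjoint_supp {S : Set ℝ} (hS : Disjoint S (supp F)) : IsConstOn F S := by
  refine ⟨fun {U W} h hU _ _ => ?_, fun U hU _ => ?_⟩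
  · have := subsingleton_of_disjoint_supp (hS.mono_left hU)
    have := subsingleton_of_disjoint_supp (hS.mono_left (Set.Subset.trans h hU))
    exact ⟨Function.injective_of_subsingleton _, Function.surjective_to_subsingleton _⟩
  · have := subsingleton_of_disjoint_supp (hS.mono_left hU)
    infer_instance

theorem IsConstOn.isOpen_inter_supp {S : Set ℝ} (hF : IsConstOn F S) (hS : IsOpen S) :
    IsOpen (S ∩ supp F) := by
  refine isOpen_iff_mem_nhds.2 fun x ⟨hxS, hxF⟩ => ?_
  obtain ⟨W, hWS, hxW, hW⟩ := exists_isInterval_nhds (U := ⟨S, hS⟩) hxS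
  refine Filter.mem_of_superset (W.isOpen.mem_nhds hxW) fun z hzW => ⟨hWS hzW, ?_⟩
  contrapose! hxF with hzF
  obtain ⟨O, hzO, hO⟩ := notMem_supp_iff.1 hzF
  obtain ⟨W', hW', -, hW'i⟩ := exists_isInterval_nhds (show z ∈ W ⊓ O from ⟨hzW, hzO⟩)
  have hsub : Subsingleton (F.obj.obj (op W)) :=
    have := hO W' (hW'.trans inf_le_right)
    (hF.bijective_res (hW'.trans inf_le_left) hWS hW hW'i).1.subsingleton
  refine notMem_supp_iff.2 ⟨W, hxW, fun V hV => ⟨fun s t => eq_of_locally_res_eq fun y hy => ?_⟩⟩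
  obtain ⟨V', hV', hyV', hV'i⟩ := exists_isInterval_nhds hy
  have := (hF.bijective_res (hV'.trans hV) hWS hW hV'i).2.subsingleton
  exact ⟨V', hV', hyV', Subsingleton.elim _ _⟩

variable {𝒮 : Set (Set ℝ)}

theorem isConstOn_of_forall_singleton_notMem (h𝒮 : Setoid.IsPartition 𝒮)
    (hopen : ∀ S ∈ 𝒮, IsOpen S ∨ ∃ x, S = {x}) (hF : ∀ S ∈ 𝒮, IsOpen S → IsConstOn F S) {O : Set ℝ}
    (hO : _root_.IsPreconnected O) (hpoint : ∀ z ∈ O, z ∈ supp F → {z} ∉ 𝒮) : IsConstOn F O := by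
  by_cases hdisj : Disjoint O (supp F)
  · exact isConstOn_of_disjoint_supp hdisj
  have hstrat (z : ℝ) (hzO : z ∈ O) (hzF : z ∈ supp F) : ∃ S ∈ 𝒮, z ∈ S ∧ IsOpen S := by
    obtain ⟨S, ⟨hS, hzS⟩, -⟩ := h𝒮.2 z
    refine ⟨S, hS, hzS, (hopen S hS).resolve_right ?_⟩
    rintro ⟨x, rfl⟩
    exact hpoint z hzO hzF (Set.mem_singleton_iff.1 hzS ▸ hS)
  obtain ⟨y, hyO, hyF⟩ := Set.not_disjoint_iff.1 hdisj
  obtain ⟨S, hS, hyS, hSo⟩ := hstrat y hyO hyF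
  let others : Set ℝ := ⋃₀ {S' ∈ 𝒮 | IsOpen S' ∧ S' ≠ S}
  have hothers : IsOpen others := isOpen_sUnion fun S' h => h.2.1
  have hsep : Disjoint (S ∩ supp F) (others ∪ (supp F)ᶜ) := by
    refine Set.disjoint_union_right.2 ⟨Set.disjoint_sUnion_right.2 fun S' h => ?_,
      disjoint_compl_right.mono_left Set.inter_subset_right⟩
    exact (h𝒮.pairwiseDisjoint hS h.1 h.2.2.symm).mono_left Set.inter_subset_left
  have hcover : O ⊆ S ∩ supp F ∪ (others ∪ (supp F)ᶜ) := by
    intro z hzO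
    by_cases hzF : z ∈ supp F
    · obtain ⟨S', hS', hzS', hSo'⟩ := hstrat z hzO hzF
      by_cases h : S' = S
      exacts [.inl ⟨h ▸ hzS', hzF⟩, .inr (.inl ⟨S', ⟨hS', hSo', h⟩, hzS'⟩)]
    · exact .inr (.inr hzF)
  have hOS : O ⊆ S ∩ supp F :=
    hO.subset_left_of_subset_union ((hF S hS hSo).isOpen_inter_supp hSo)
      (hothers.union isClosed_supp.isOpen_compl) hsep hcover ⟨y, hyO, hyS, hyF⟩
  exact (hF S hS hSo).mono (hOS.trans Set.inter_subset_left)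

theorem exists_iso_of_isConstantOfFiniteRank (h𝒮 : Setoid.IsPartition 𝒮)
    (hopen : ∀ S ∈ 𝒮, IsOpen S ∨ ∃ x, S = {x})
    (hF : ∀ S ∈ 𝒮, IsConstantOfFiniteRank (restrict F S))
    (hfin : {t ∈ supp F | {t} ∈ 𝒮}.Finite) :
    ∃ (A : Type) (_ : Finite A) (I : A → Set ℝ), (∀ a, IsInterval (I a)) ∧
      Nonempty (F ≅ ⨁ fun a => kSheaf k (I a)) := by
  let T : Finset ℝ := hfin.toFinset
  have hmemT {t : ℝ} : Odd (stratumIndex T t) ↔ t ∈ supp F ∧ {t} ∈ 𝒮 := by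
    rw [odd_stratumIndex_iff]
    exact hfin.mem_toFinset
  have hF' : IsAdapted F (isStratumIndex_stratumIndex (T := T)) := by
    refine isAdapted_of_isConstOn _ (fun O hO heven => ?_) fun y hy => ?_
    · refine isConstOn_of_forall_singleton_notMem h𝒮 hopen
        (fun S hS hSo => isConstOn_of_restrict hSo (hF S hS)) hO.isPreconnected
        fun z hzO hzF hz => ?_
      exact Nat.not_odd_iff_even.2 (heven z hzO) (hmemT.2 ⟨hzF, hz⟩)
    · exact finite_stalk_of_restrict_singleton (hF _ (hmemT.1 hy).2)
  exact hF'.exists_iso (stratumIndex_le T)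

end Support

/-! ### Morphisms between the sheaves `k_I` -/

section LocallyClosed

theorem isLocallyClosed_of_isUpperSet {X : Type*} [LinearOrder X] [TopologicalSpace X]
    [OrderClosedTopology X] {s : Set X} (hs : IsUpperSet s) : IsLocallyClosed s := by
  by_cases h : ∃ a, IsLeast s a
  · obtain ⟨a, ha, hle⟩ := h
    have : s = Set.Ici a := Set.Subset.antisymm (fun x hx => hle hx) fun x hx => hs hx ha
    exact this ▸ isLocallyClosed_Ici
  · refine (isOpen_iff_mem_nhds.2 fun x hx => ?_).isLocallyClosed
    obtain ⟨y, hy, hyx⟩ : ∃ y ∈ s, y < x := by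
      by_contra! hle
      exact h ⟨x, hx, hle⟩
    exact Filter.mem_of_superset (Ioi_mem_nhds hyx) fun z hz => hs hz.le hy

theorem isLocallyClosed_of_ordConnected {X : Type*} [LinearOrder X] [TopologicalSpace X]
    [OrderClosedTopology X] {s : Set X} (hs : s.OrdConnected) : IsLocallyClosed s :=
  hs.upperClosure_inter_lowerClosure ▸ (isLocallyClosed_of_isUpperSet (upperClosure s).upper).inter
    (isLocallyClosed_of_isUpperSet (X := Xᵒᵈ) (lowerClosure s).lower.toDual)

end LocallyClosed

section Coefficient

variable {k : Type u} [Field k] {I J K : Set ℝ}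

variable (k) in
theorem exists_section_eq_one (hI : IsLocallyClosed I) :
    ∃ (W : Opens (TopCat.of ℝ)) (_ : I ⊆ W) (e : extSections k I W),
      ∀ y : W, y.1 ∈ I → e.1 y = 1 := by
  classical
  obtain ⟨U, Z, hU, hZ, rfl⟩ := hI
  let e (y : (⟨U, hU⟩ : Opens (TopCat.of ℝ))) : k := if y.1 ∈ U ∩ Z then 1 else 0
  have he : IsExtSection (U ∩ Z) e := by
    refine ⟨fun y hy => if_neg hy, ?_, ?_⟩
    · rw [show (fun y : {y : (⟨U, hU⟩ : Opens (TopCat.of ℝ)) // y.1 ∈ U ∩ Z} => e y.1) =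
        fun _ => 1 from funext fun y => if_pos y.2]
      exact IsLocallyConstant.const 1
    · have hsupp : {y | e y ≠ 0} = Subtype.val ⁻¹' Z := by
        ext y
        simp [e]
      exact hsupp ▸ hZ.preimage continuous_subtype_val
  exact ⟨⟨U, hU⟩, Set.inter_subset_left, ⟨e, he⟩, fun y hy => if_pos hy⟩

theorem homApply_apply_eq_zero (α : kSheaf k I ⟶ kSheaf k J) {U : Opens (TopCat.of ℝ)}
    {s : extSections k I U} {x : U} (hs : s.1 x = 0) :
    (homApply α U s : extSections k J U).1 x = 0 := by
  obtain ⟨V, hV, hxV, hsV⟩ := exists_le_of_eventually x.2 (((isExtSection_iff _ _).1 s.2).2.2 x hs)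
  have hres : res (kSheaf k I) hV s = 0 := Subtype.ext (funext fun y => hsV y.1 y.2)
  have hαs : res (kSheaf k J) hV (homApply α U s) = 0 := by
    rw [← homApply_res α hV s, hres, map_zero]
  exact congrArg (fun t : extSections k J V => t.1 ⟨x.1, hxV⟩) hαs

theorem homApply_apply_mul_comm (α : kSheaf k I ⟶ kSheaf k J) {U V : Opens (TopCat.of ℝ)}
    (s : extSections k I U) (t : extSections k I V) {x : ℝ} (hxU : x ∈ U) (hxV : x ∈ V) :
    (homApply α U s : extSections k J U).1 ⟨x, hxU⟩ * t.1 ⟨x, hxV⟩ =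
      (homApply α V t : extSections k J V).1 ⟨x, hxV⟩ * s.1 ⟨x, hxU⟩ := by
  let x' : (U ⊓ V : Opens (TopCat.of ℝ)) := ⟨x, hxU, hxV⟩
  let s' : extSections k I (U ⊓ V) := res (kSheaf k I) inf_le_left s
  let t' : extSections k I (U ⊓ V) := res (kSheaf k I) inf_le_right t
  let ev : extSections k I (U ⊓ V) →ₗ[k] k :=
    LinearMap.proj x' ∘ₗ (extSections k J (U ⊓ V)).subtype ∘ₗ homApply α (U ⊓ V)
  have hs : ev s' = (homApply α U s : extSections k J U).1 ⟨x, hxU⟩ :=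
    congrArg (fun r : extSections k J (U ⊓ V) => r.1 x') (homApply_res α inf_le_left s)
  have ht : ev t' = (homApply α V t : extSections k J V).1 ⟨x, hxV⟩ :=
    congrArg (fun r : extSections k J (U ⊓ V) => r.1 x') (homApply_res α inf_le_right t)
  have hzero : ev (t.1 ⟨x, hxV⟩ • s' - s.1 ⟨x, hxU⟩ • t') = 0 := by
    refine homApply_apply_eq_zero (x := x') α ?_
    change t.1 _ * s.1 _ - s.1 _ * t.1 _ = 0
    ring
  rw [map_sub, map_smul, map_smul, hs, ht, sub_eq_zero, smul_eq_mul, smul_eq_mul] at hzero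
  rw [mul_comm, hzero, mul_comm]

theorem exists_homApply_apply_eq_mul (α : kSheaf k I ⟶ kSheaf k J) (x : ℝ) :
    ∃ c : k, ∀ (U : Opens (TopCat.of ℝ)) (s : extSections k I U) (hx : x ∈ U),
      (homApply α U s : extSections k J U).1 ⟨x, hx⟩ = c * s.1 ⟨x, hx⟩ := by
  by_cases h : ∃ (V : Opens (TopCat.of ℝ)) (t : extSections k I V) (hx : x ∈ V), t.1 ⟨x, hx⟩ ≠ 0
  · obtain ⟨V, t, hxV, ht⟩ := h
    refine ⟨(homApply α V t : extSections k J V).1 ⟨x, hxV⟩ / t.1 ⟨x, hxV⟩, fun U s hxU => ?_⟩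
    rw [div_mul_eq_mul_div, eq_div_iff ht, homApply_apply_mul_comm α s t]
  · push Not at h
    exact ⟨0, fun U s hxU => by rw [homApply_apply_eq_zero α (h U s hxU), zero_mul]⟩

/-- The scalar by which a morphism `k_I ⟶ k_J` acts on the values of sections at `x`. It is only
determined if `x ∈ I`. -/
def coeff (α : kSheaf k I ⟶ kSheaf k J) (x : ℝ) : k :=
  (exists_homApply_apply_eq_mul α x).choose

theorem homApply_apply (α : kSheaf k I ⟶ kSheaf k J) {U : Opens (TopCat.of ℝ)}
    (s : extSections k I U) (x : U) :
    (homApply α U s : extSections k J U).1 x = coeff α x * s.1 x :=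
  (exists_homApply_apply_eq_mul α x.1).choose_spec U s x.2

variable (hI : IsLocallyClosed I) {x : ℝ} (hx : x ∈ I)
include hI hx

theorem coeff_eq_of_homApply_apply (α : kSheaf k I ⟶ kSheaf k J) {c : k}
    (hc : ∀ (U : Opens (TopCat.of ℝ)) (s : extSections k I U) (hx : x ∈ U),
      (homApply α U s : extSections k J U).1 ⟨x, hx⟩ = c * s.1 ⟨x, hx⟩) : coeff α x = c := by
  obtain ⟨W, hW, e, he⟩ := exists_section_eq_one k hI
  have h := hc W e (hW hx)
  rwa [homApply_apply, he _ hx, mul_one, mul_one] at h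

theorem coeff_id : coeff (𝟙 (kSheaf k I)) x = 1 :=
  coeff_eq_of_homApply_apply hI hx _ fun _ _ _ => (one_mul _).symm

theorem coeff_comp (α : kSheaf k I ⟶ kSheaf k J) (β : kSheaf k J ⟶ kSheaf k K) :
    coeff (α ≫ β) x = coeff β x * coeff α x :=
  coeff_eq_of_homApply_apply hI hx _ fun U s hxU =>
    (homApply_apply β (homApply α U s) ⟨x, hxU⟩).trans (by rw [homApply_apply α, mul_assoc])

theorem coeff_eq_zero (α : kSheaf k I ⟶ kSheaf k J) (hxJ : x ∉ J) : coeff α x = 0 :=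
  coeff_eq_of_homApply_apply hI hx _ fun U s hxU =>
    ((homApply α U s : extSections k J U).2.1 ⟨x, hxU⟩ hxJ).trans (zero_mul _).symm

theorem coeff_zero : coeff (0 : kSheaf k I ⟶ kSheaf k J) x = 0 :=
  coeff_eq_of_homApply_apply hI hx _ fun _ _ _ => (zero_mul _).symm

theorem coeff_add (α β : kSheaf k I ⟶ kSheaf k J) : coeff (α + β) x = coeff α x + coeff β x :=
  coeff_eq_of_homApply_apply hI hx _ fun U s hxU => by
    rw [add_mul, ← homApply_apply α s ⟨x, hxU⟩, ← homApply_apply β s ⟨x, hxU⟩]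
    rfl

theorem coeff_sum {ι : Type*} (A : Finset ι) (α : ι → (kSheaf k I ⟶ kSheaf k J)) :
    coeff (∑ i ∈ A, α i) x = ∑ i ∈ A, coeff (α i) x :=
  map_sum (AddMonoidHom.mk' (coeff (k := k) (I := I) (J := J) · x) (coeff_add hI hx)) α A

omit hI hx in
theorem coeff_eq_coeff (hI : I.OrdConnected) (α : kSheaf k I ⟶ kSheaf k I) {x y : ℝ} (hx : x ∈ I)
    (hy : y ∈ I) : coeff α x = coeff α y := by
  obtain ⟨W, hW, e, he⟩ := exists_section_eq_one k (isLocallyClosed_of_ordConnected hI)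
  have : PreconnectedSpace I := Subtype.preconnectedSpace hI.isPreconnected
  have hconst : IsLocallyConstant fun y : I => coeff α y := by
    convert (homApply α W e : extSections k I W).2.2.1.comp_continuous
      (show Continuous fun y : I => (⟨⟨y.1, hW y.2⟩, y.2⟩ : {y : W // y.1 ∈ I}) by fun_prop)
      with y
    rw [Function.comp_apply, homApply_apply, he _ y.2, mul_one]
  exact hconst.apply_eq_of_preconnectedSpace ⟨x, hx⟩ ⟨y, hy⟩

omit hI in
/-- If `z` lies in only one of `I` and `J`, then one of the two composites is multiplication by a
constant which is zero at `z`. -/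
theorem coeff_mul_coeff_eq_zero (hI : I.OrdConnected) (hJ : J.OrdConnected) (hIJ : I ≠ J)
    (hIK : I = K) (α : kSheaf k I ⟶ kSheaf k J) (β : kSheaf k J ⟶ kSheaf k K) :
    coeff β x * coeff α x = 0 := by
  subst hIK
  have hI' := isLocallyClosed_of_ordConnected hI
  have hJ' := isLocallyClosed_of_ordConnected hJ
  by_cases hsub : I ⊆ J
  · obtain ⟨z, hzJ, hzI⟩ := Set.exists_of_ssubset (hsub.ssubset_of_ne hIJ)
    rw [mul_comm, ← coeff_comp hJ' (hsub hx), coeff_eq_coeff hJ _ (hsub hx) hzJ,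
      coeff_comp hJ' hzJ, coeff_eq_zero hJ' hzJ β hzI, mul_zero]
  · obtain ⟨z, hzI, hzJ⟩ := Set.not_subset.1 hsub
    rw [← coeff_comp hI' hx, coeff_eq_coeff hI _ hx hzI, coeff_comp hI' hzI,
      coeff_eq_zero hI' hzI α hzJ, mul_zero]

end Coefficient

/-! ### Uniqueness of decompositions -/

section Uniqueness

theorem sum_comp_biproduct_π_comp_biproduct_ι_comp {C : Type*} [Category* C] [Preadditive C]
    {Q : Type*} [Fintype Q] (H : Q → C) [HasBiproduct H] {X Y : C} (f : X ⟶ ⨁ H) (g : ⨁ H ⟶ Y) :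
    ∑ q, (f ≫ biproduct.π H q) ≫ biproduct.ι H q ≫ g = f ≫ g := by
  have htotal : ∑ q, biproduct.π H q ≫ biproduct.ι H q = 𝟙 (⨁ H) :=
    IsBilimit.total (biproduct.isBilimit H)
  calc
    _ = f ≫ (∑ q, biproduct.π H q ≫ biproduct.ι H q) ≫ g := by
      simp only [Preadditive.comp_sum, Preadditive.sum_comp, Category.assoc]
    _ = f ≫ g := by rw [htotal, Category.id_comp]

variable {k : Type u} [Field k]

/-- The matrix of the values at `x` of the components of a morphism `⨁ k_{I p} ⟶ ⨁ k_{J q}`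
between the summands with `I p = S` and those with `J q = S`. -/
def coeffMatrix {P : Type v} {Q : Type w} [Finite P] [Finite Q] {I : P → Set ℝ} {J : Q → Set ℝ}
    (f : (⨁ fun p => kSheaf k (I p)) ⟶ ⨁ fun q => kSheaf k (J q)) (S : Set ℝ) (x : ℝ) :
    Matrix {q // J q = S} {p // I p = S} k :=
  .of fun q p => coeff
    (biproduct.ι (fun p => kSheaf k (I p)) p.1 ≫ f ≫ biproduct.π (fun q => kSheaf k (J q)) q.1) x

variable {P : Type v} {Q : Type w} {R : Type*} [Finite P] [Finite Q] [Finite R] {I : P → Set ℝ}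
  {J : Q → Set ℝ} {K : R → Set ℝ} {S : Set ℝ} {x : ℝ}

theorem coeffMatrix_id [DecidableEq P] (hS : IsLocallyClosed S) (hx : x ∈ S) :
    coeffMatrix (𝟙 (⨁ fun p => kSheaf k (I p))) S x = 1 := by
  ext ⟨p', hp'⟩ ⟨p, hp⟩
  rw [Matrix.one_apply, coeffMatrix, Matrix.of_apply, Category.id_comp]
  by_cases h : p = p'
  · subst h
    subst hp
    rw [biproduct.ι_π_self, coeff_id hS hx, if_pos rfl]
  · subst hp
    rw [biproduct.ι_π_ne _ h, coeff_zero hS hx, if_neg (by simpa using Ne.symm h)]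

theorem coeffMatrix_comp [Fintype {q // J q = S}] (hI : ∀ p, (I p).OrdConnected)
    (hJ : ∀ q, (J q).OrdConnected) (hx : x ∈ S)
    (f : (⨁ fun p => kSheaf k (I p)) ⟶ ⨁ fun q => kSheaf k (J q))
    (g : (⨁ fun q => kSheaf k (J q)) ⟶ ⨁ fun r => kSheaf k (K r)) :
    coeffMatrix (f ≫ g) S x = coeffMatrix g S x * coeffMatrix f S x := by
  classical
  cases nonempty_fintype Q
  ext ⟨r, hr⟩ ⟨p, hp⟩
  have hxp : x ∈ I p := hp ▸ hx
  have hlc := isLocallyClosed_of_ordConnected (hI p)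
  let a (q : Q) : kSheaf k (I p) ⟶ kSheaf k (J q) :=
    (biproduct.ι (fun p => kSheaf k (I p)) p ≫ f) ≫ biproduct.π (fun q => kSheaf k (J q)) q
  let b (q : Q) : kSheaf k (J q) ⟶ kSheaf k (K r) :=
    biproduct.ι (fun q => kSheaf k (J q)) q ≫ g ≫ biproduct.π (fun r => kSheaf k (K r)) r
  have hzero (q : Q) (hq : J q ≠ S) : coeff (b q) x * coeff (a q) x = 0 :=
    coeff_mul_coeff_eq_zero hxp (hI p) (hJ q) (fun h => hq (h ▸ hp)) (hp.trans hr.symm) _ _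
  calc
    coeffMatrix (f ≫ g) S x ⟨r, hr⟩ ⟨p, hp⟩ = coeff (∑ q, a q ≫ b q) x := by
      rw [sum_comp_biproduct_π_comp_biproduct_ι_comp, coeffMatrix, Matrix.of_apply]
      simp only [Category.assoc]
    _ = ∑ q, coeff (b q) x * coeff (a q) x := by
      rw [coeff_sum hlc hxp]
      exact Finset.sum_congr rfl fun q _ => coeff_comp hlc hxp _ _
    _ = ∑ q : {q // J q = S}, coeff (b q) x * coeff (a q) x := by
      rw [← Finset.sum_subtype (Finset.univ.filter fun q => J q = S) (by simp)
        fun q => coeff (b q) x * coeff (a q) x]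
      exact (Finset.sum_subset (Finset.subset_univ _)
        fun q _ hq => hzero q (by simpa using hq)).symm
    _ = (coeffMatrix g S x * coeffMatrix f S x) ⟨r, hr⟩ ⟨p, hp⟩ := by
      simp only [Matrix.mul_apply, coeffMatrix, Matrix.of_apply, a, b, Category.assoc]

theorem card_le_card_of_iso (hI : ∀ p, (I p).OrdConnected) (hJ : ∀ q, (J q).OrdConnected)
    (hS : IsInterval S) (θ : (⨁ fun p => kSheaf k (I p)) ≅ ⨁ fun q => kSheaf k (J q)) :
    Nat.card {p // I p = S} ≤ Nat.card {q // J q = S} := by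
  classical
  cases nonempty_fintype {p // I p = S}
  cases nonempty_fintype {q // J q = S}
  obtain ⟨x, hx⟩ := hS.1
  have hone : coeffMatrix θ.inv S x * coeffMatrix θ.hom S x = 1 := by
    rw [← coeffMatrix_comp hI hJ hx, θ.hom_inv_id,
      coeffMatrix_id (isLocallyClosed_of_ordConnected hS.2) hx]
  rw [Nat.card_eq_fintype_card, Nat.card_eq_fintype_card]
  calc
    Fintype.card {p // I p = S} = (coeffMatrix θ.inv S x * coeffMatrix θ.hom S x).rank := by
      rw [hone, Matrix.rank_one]
    _ ≤ (coeffMatrix θ.inv S x).rank := Matrix.rank_mul_le_left _ _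
    _ ≤ Fintype.card {q // J q = S} := Matrix.rank_le_card_width _

theorem card_sigma_fin {B β : Type*} {f : B → β} (hf : Function.Injective f) (m : B → ℕ) (b : B) :
    Nat.card {q : Σ b, Fin (m b) // f q.1 = f b} = m b := by
  have h : Function.Bijective fun i : Fin (m b) =>
      (⟨⟨b, i⟩, rfl⟩ : {q : Σ b, Fin (m b) // f q.1 = f b}) := by
    constructor
    · intro i i' h
      simpa using h
    · rintro ⟨⟨b', i⟩, h⟩
      obtain rfl := hf h
      exact ⟨i, rfl⟩
  rw [← Nat.card_eq_of_bijective _ h, Nat.card_fin]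

namespace IsDecomposition

variable {F : Sh k ℝ} {A : Type v} {B : Type w} [Finite A] [Finite B] {I : A → Set ℝ} {n : A → ℕ}
  {J : B → Set ℝ} {m : B → ℕ}

theorem exists_le (hI : IsDecomposition F I n) (hIinj : Function.Injective I) (hn : ∀ a, 0 < n a)
    (hJ : IsDecomposition F J m) (hJinj : Function.Injective J) (a : A) :
    ∃ b, J b = I a ∧ n a ≤ m b := by
  obtain ⟨hI, ⟨e⟩⟩ := hI
  obtain ⟨hJ, ⟨e'⟩⟩ := hJ
  have hle := card_le_card_of_iso (k := k) (I := fun p : Σ a, Fin (n a) => I p.1)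
    (J := fun q : Σ b, Fin (m b) => J q.1) (fun p => (hI p.1).2) (fun q => (hJ q.1).2) (hI a)
    ((biproductBiproductIso _ fun a (_ : Fin (n a)) => kSheaf k (I a)).symm ≪≫ e.symm ≪≫ e' ≪≫
      biproductBiproductIso _ fun b (_ : Fin (m b)) => kSheaf k (J b))
  rw [card_sigma_fin hIinj] at hle
  obtain ⟨⟨⟨b, _⟩, hb⟩⟩ := (Nat.card_pos_iff.1 ((hn a).trans_le hle)).1
  exact ⟨b, hb, by rwa [← hb, card_sigma_fin hJinj] at hle⟩

theorem exists_equiv (hI : IsDecomposition F I n) (hIinj : Function.Injective I)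
    (hn : ∀ a, 0 < n a) (hJ : IsDecomposition F J m) (hJinj : Function.Injective J)
    (hm : ∀ b, 0 < m b) : ∃ σ : A ≃ B, ∀ a, J (σ a) = I a ∧ m (σ a) = n a := by
  choose σ hσ hnm using hI.exists_le hIinj hn hJ hJinj
  choose τ hτ hmn using hJ.exists_le hJinj hm hI hIinj
  have hτσ (a : A) : τ (σ a) = a := hIinj ((hτ _).trans (hσ a))
  have hστ (b : B) : σ (τ b) = b := hJinj ((hσ _).trans (hτ b))
  refine ⟨⟨σ, τ, hτσ, hστ⟩, fun a => ⟨hσ a, le_antisymm ?_ (hnm a)⟩⟩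
  exact (hmn (σ a)).trans_eq (congrArg n (hτσ a))

end IsDecomposition

end Uniqueness

theorem exists_isDecomposition_of_iso {k : Type u} [Field k] {F : Sh k ℝ} {P : Type} [Finite P]
    {I : P → Set ℝ} (hI : ∀ p, IsInterval (I p)) (e : F ≅ ⨁ fun p => kSheaf k (I p)) :
    ∃ (A : Type) (_ : Finite A) (I : A → Set ℝ) (n : A → ℕ),
      IsDecomposition F I n ∧ Function.Injective I ∧ ∀ a, 0 < n a := by
  let r : P → Set.range I := Set.rangeFactorization I
  let n (S : Set.range I) : ℕ := Nat.card {p // r p = S}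
  let ε : (Σ S, Fin (n S)) ≃ P :=
    (Equiv.sigmaCongrRight fun S => (Finite.equivFin {p // r p = S}).symm).trans
      (Equiv.sigmaFiberEquiv r)
  have hε (q : Σ S, Fin (n S)) : I (ε q) = q.1 :=
    congrArg Subtype.val ((Finite.equivFin {p // r p = q.1}).symm q.2).2
  refine ⟨Set.range I, inferInstance, Subtype.val, n, ⟨?_, ⟨?_⟩⟩, Subtype.val_injective, ?_⟩
  · rintro ⟨_, p, rfl⟩
    exact hI p
  · exact e ≪≫ (biproduct.whiskerEquiv ε fun q => eqToIso (by rw [hε])).symm ≪≫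
      (biproductBiproductIso _ fun (S : Set.range I) (_ : Fin (n S)) => kSheaf k S.1).symm
  · rintro ⟨_, p, rfl⟩
    exact Nat.card_pos_iff.2 ⟨⟨⟨p, rfl⟩⟩, inferInstance⟩

end SheavesOnR

end

theorem mainTheorem5_general (k : Type u) [Field k] (F : SheavesOnR.Sh k ℝ) (𝒮 : Set (Set ℝ))
    (h𝒮 : Setoid.IsPartition 𝒮) (hopen : ∀ S ∈ 𝒮, IsOpen S ∨ ∃ x, S = {x})
    (hF : ∀ S ∈ 𝒮, SheavesOnR.IsConstantOfFiniteRank (SheavesOnR.restrict F S))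
    (hfin : {t ∈ SheavesOnR.supp F | {t} ∈ 𝒮}.Finite) :
    (∃ (A : Type) (_ : Finite A) (I : A → Set ℝ) (n : A → ℕ),
      SheavesOnR.IsDecomposition F I n ∧ Function.Injective I ∧ ∀ a, 0 < n a) ∧
    (∀ (A : Type v) (B : Type w) [Finite A] [Finite B] (I : A → Set ℝ) (n : A → ℕ)
      (J : B → Set ℝ) (m : B → ℕ),
      SheavesOnR.IsDecomposition F I n → Function.Injective I → (∀ a, 0 < n a) →
      SheavesOnR.IsDecomposition F J m → Function.Injective J → (∀ b, 0 < m b) →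
      ∃ σ : A ≃ B, ∀ a, J (σ a) = I a ∧ m (σ a) = n a) := by
  constructor
  · obtain ⟨P, _, I, hI, ⟨e⟩⟩ :=
      SheavesOnR.exists_iso_of_isConstantOfFiniteRank h𝒮 hopen hF hfin
    exact SheavesOnR.exists_isDecomposition_of_iso hI e
  · intro A B _ _ I n J m hI hIinj hn hJ hJinj hm
    exact hI.exists_equiv hIinj hn hJ hJinj hm

theorem mainTheorem5 (k : Type u) [Field k] (F : SheavesOnR.Sh k ℝ)
    (hF : SheavesOnR.IsConstructible F) (hsupp : IsCompact (SheavesOnR.supp F)) :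
    (∃ (A : Type) (_ : Finite A) (I : A → Set ℝ) (n : A → ℕ),
      SheavesOnR.IsDecomposition F I n ∧ Function.Injective I ∧ ∀ a, 0 < n a) ∧
    (∀ (A : Type v) (B : Type w) [Finite A] [Finite B] (I : A → Set ℝ) (n : A → ℕ)
      (J : B → Set ℝ) (m : B → ℕ),
      SheavesOnR.IsDecomposition F I n → Function.Injective I → (∀ a, 0 < n a) →
      SheavesOnR.IsDecomposition F J m → Function.Injective J → (∀ b, 0 < m b) →
      ∃ σ : A ≃ B, ∀ a, J (σ a) = I a ∧ m (σ a) = n a) := by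
  obtain ⟨𝒮, h𝒮, hconst⟩ := hF
  exact mainTheorem5_general k F 𝒮 h𝒮.partition (fun S hS => h𝒮.isOpen_or_eq_singleton hS) hconst
    (h𝒮.finite_point_strata hsupp)
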